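/- Let $k$ be a field, let $\mathbb{G}_m=\operatorname{Spec}k[T,T^{-1}]$ be the multiplicative group over $k$, and let $Y$ be an algebraic variety over $k$ (an integral separated scheme of finite type over $k$) with an action $\sigma\colon \mathbb{G}_m\times Y\to Y$. Suppose that there is a point $y\in Y(k)$ whose orbit $\mathbb{G}_m\cdot y$ is an open dense subset of $Y$ which, as an open subscheme, is isomorphic over $k$ to $\mathbb{G}_m$, and that the two endpoints of this orbit are identified: there is a point $z\in Y(k)$ with $$\lim_{t\to 0}t\cdot y=z=\lim_{t\to\infty}t\cdot y,$$ that is, each of the morphisms $\mathbb{G}_m\to Y$, $t\mapsto t\cdot y$ and $t\mapsto t^{-1}\cdot y$, extends to a morphism $\mathbb{A}^1_k\to Y$ sending $0$ to $z$. Then there is no ample $\mathbb{G}_m$-linearized line bundle on $Y$: there is no ample line bundle $L$ on $Y$ with an isomorphism $\Phi\colon\sigma^*L\cong \mathrm{pr}_2^*L$ on $\mathbb{G}_m\times Y$ satisfying the cocycle condition $(\mu\times 1)^*\Phi=\mathrm{pr}_{23}^*\Phi\circ(1\times\sigma)^*\Phi$ on $\mathbb{G}_m\times\mathbb{G}_m\times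 Y$, where $\mu$ is the multiplication of $\mathbb{G}_m$. -/

import Mathlib

open AlgebraicGeometry CategoryTheory MonoidalCategory CartesianMonoidalCategory
open scoped LaurentPolynomial Polynomial MonObj

universe u

noncomputable section

/-! ### Invertible sheaves, tensor powers and ampleness -/

namespace AlgebraicGeometry.Scheme.Modules

variable {X Y Z : Scheme.{u}}

/-- A line bundle (invertible sheaf): an `𝒪_X`-module that is locally isomorphic to `𝒪_X`. -/
def IsLineBundle (L : X.Modules) : Prop :=
  ∀ x : X, ∃ U : X.Opens, x ∈ U ∧
    Nonempty (L.restrict U.ι ≅ SheafOfModules.unit (U : Scheme.{u}).ringCatSheaf)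

/-- The tensor product of two `𝒪_X`-modules: the sheafification of the presheaf
`U ↦ Γ(M, U) ⊗ Γ(N, U)`. -/
def tensor (M N : X.Modules) : X.Modules :=
  (PresheafOfModules.sheafification (𝟙 X.ringCatSheaf.obj)).obj
    (PresheafOfModules.Monoidal.tensorObj (R := X.presheaf) M.val N.val)

/-- The tensor powers `L^{⊗ n}`. -/
def tensorPow (L : X.Modules) : ℕ → X.Modules
  | 0 => SheafOfModules.unit X.ringCatSheaf
  | n + 1 => tensor (tensorPow L n) L

/-- The section `s ∈ Γ(M, U)` is a frame of `M` on `U`: multiplication by `s` is an isomorphism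
`𝒪_U ≅ M|_U`. -/
def IsFrame (M : X.Modules) {U : X.Opens} (s : Γ(M, U)) : Prop :=
  ∀ (V : X.Opens) (h : V ≤ U), Function.Bijective
    fun r : Γ(X, V) ↦ r • (M.presheaf.map (homOfLE h).op s : Γ(M, V))

/-- For a line bundle `M` and a global section `s` of `M`, the open set `X_s` of points at which
`s` does not vanish, i.e. near which `s` is a frame of `M`. -/
def nonvanishingLocus (M : X.Modules) (s : Γ(M, ⊤)) : X.Opens :=
  sSup {U | M.IsFrame (M.presheaf.map (homOfLE (le_top : U ≤ ⊤)).op s : Γ(M, U))}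

/-- A line bundle `L` on a scheme `X` is ample if `X` is quasi-compact and every point of `X` lies
in an affine open of the form `X_s` with `s` a global section of `L^{⊗ n}` and `n ≥ 1`. -/
structure IsAmple (L : X.Modules) : Prop where
  isLineBundle : L.IsLineBundle
  compactSpace : CompactSpace X
  exists_isAffineOpen (x : X) : ∃ n : ℕ, 1 ≤ n ∧ ∃ s : Γ(L.tensorPow n, ⊤),
    x ∈ (L.tensorPow n).nonvanishingLocus s ∧ IsAffineOpen ((L.tensorPow n).nonvanishingLocus s)

/-- The base change `f^* Φ : a'^* L ≅ b'^* L` of an isomorphism `Φ : a^* L ≅ b^* L`, where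
`a' = a ∘ f` and `b' = b ∘ f`. -/
def baseChangeIso {L : X.Modules} {a b : Y ⟶ X}
    (Φ : (pullback a).obj L ≅ (pullback b).obj L) (f : Z ⟶ Y) {a' b' : Z ⟶ X}
    (ha : f ≫ a = a') (hb : f ≫ b = b') : (pullback a').obj L ≅ (pullback b').obj L :=
  (pullbackCongr ha).symm.app L ≪≫ (pullbackComp f a).symm.app L ≪≫ (pullback f).mapIso Φ ≪≫
    (pullbackComp f b).app L ≪≫ (pullbackCongr hb).app L

end AlgebraicGeometry.Scheme.Modules

/-! ### Group actions and linearizations -/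

section Action

variable {S : Scheme.{u}}

variable (G : Over S) [GrpObj G] (Y : Over S) [ModObj G Y]

/-- Let the group scheme `G` act on `Y` over `S`, with action morphism `act = γ[G, Y]`.
A `G`-linearization of an `𝒪_Y`-module `L` is an isomorphism `Φ : act^* L ≅ pr₂^* L` on `G × Y`
satisfying the cocycle condition `(μ × 1)^* Φ = pr₂₃^* Φ ∘ (1 × act)^* Φ` on `G × G × Y`. -/
structure Linearization (L : Y.left.Modules) where
  /-- The isomorphism `act^* L ≅ pr₂^* L`. -/
  iso : (Scheme.Modules.pullback γ[G, Y].left).obj L ≅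
    (Scheme.Modules.pullback (snd G Y).left).obj L
  /-- The cocycle condition. -/
  cocycle :
    Scheme.Modules.baseChangeIso iso (μ[G] ▷ Y).left
        (a' := ((α_ G G Y).hom ≫ G ◁ γ[G, Y] ≫ γ[G, Y]).left)
        (b' := ((α_ G G Y).hom ≫ snd G (G ⊗ Y) ≫ snd G Y).left)
        (by rw [← Over.comp_left, ModObj.mul_smul_self])
        (by rw [← Over.comp_left]; simp) =
      Scheme.Modules.baseChangeIso iso ((α_ G G Y).hom ≫ G ◁ γ[G, Y]).left
          (b' := ((α_ G G Y).hom ≫ snd G (G ⊗ Y) ≫ γ[G, Y]).left)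
          (by rw [← Over.comp_left]; simp)
          (by rw [← Over.comp_left]; simp) ≪≫
        Scheme.Modules.baseChangeIso iso ((α_ G G Y).hom ≫ snd G (G ⊗ Y)).left
          (by rw [← Over.comp_left]; simp)
          (by rw [← Over.comp_left]; simp)

variable {Y} in
/-- The orbit morphism `G ⟶ Y`, `g ↦ g · y`, of an `S`-point `y` of `Y`. -/
def orbitMap (y : 𝟙_ (Over S) ⟶ Y) : G ⟶ Y :=
  lift (𝟙 G) (toUnit G ≫ y) ≫ γ[G, Y]

end Action

/-! ### The multiplicative group and limits of its orbits -/

section Gm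

variable (k : Type u) [Field k]

/-- The multiplicative group `Spec k[T, T⁻¹]` over `Spec k`; its group structure is the one given
by the Hopf algebra structure of `k[T, T⁻¹] = k[ℤ]`. -/
abbrev Gm : Over (Spec (.of k)) := (Spec (.of k[T;T⁻¹])).asOver (Spec (.of k))

/-- The affine line `Spec k[X]` over `Spec k`. -/
abbrev affineLine : Over (Spec (.of k)) := (Spec (.of k[X])).asOver (Spec (.of k))

/-- The inclusion of `𝔾ₘ` into the affine line as the complement of the origin. -/
def GmToAffineLine : Gm k ⟶ affineLine k :=
  (Spec.map (CommRingCat.ofHom (Polynomial.toLaurentAlg (R := k)).toRingHom)).asOver _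

/-- The origin of the affine line, as a `k`-point. -/
def affineLineZero : 𝟙_ (Over (Spec (.of k))) ⟶ affineLine k :=
  Over.homMk (Spec.map (CommRingCat.ofHom (Polynomial.evalRingHom (0 : k)))) (by
    change Spec.map (CommRingCat.ofHom (Polynomial.evalRingHom (0 : k))) ≫
      Spec.map (CommRingCat.ofHom (algebraMap k k[X])) = 𝟙 _
    rw [← Spec.map_comp, ← CommRingCat.ofHom_comp, ← Spec.map_id]
    congr 2
    ext r
    simp)

variable {k} {Y : Over (Spec (.of k))}

/-- `lim_{t → 0} c(t) = z`: the morphism `c : 𝔾ₘ ⟶ Y` extends to the affine line, and the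
extension sends the origin to `z`. -/
def TendsToAtZero (c : Gm k ⟶ Y) (z : 𝟙_ (Over (Spec (.of k))) ⟶ Y) : Prop :=
  ∃ φ : affineLine k ⟶ Y, GmToAffineLine k ≫ φ = c ∧ affineLineZero k ≫ φ = z

/-- `lim_{t → ∞} c(t) = z`, i.e. `lim_{t → 0} c(t⁻¹) = z`. -/
def TendsToAtInfinity (c : Gm k ⟶ Y) (z : 𝟙_ (Over (Spec (.of k))) ⟶ Y) : Prop :=
  TendsToAtZero (ι[Gm k] ≫ c) z

end Gm

end

/-! Suppose that `L` is ample with a linearization `Φ`, and choose a section `s` of a power `L^n`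
such that `X_s` is affine and contains `z`. Along the orbit map `t ↦ t · y` the linearization
trivializes the pullback of `L`, so `s` becomes a Laurent polynomial `p`.

The order of `p` at `0` is governed by the weight of the action on the fibre of `L` at `z`. In terms
of a frame of `L` near `z`, the linearization along the orbit is a rational function `q`, and `p` is
`q ^ n` times a function that is invertible at the limit because `s(z) ≠ 0`. The cocycle condition
gives `q(t x) = β(t, x) q(x)` with `β` regular at `x = 0`, where `β(t, 0)` is the character through
which `t` acts on the fibre at `z`. If `q` has order `m` at `0`, this character is `t ^ m`
(`exists_order`, `ExtendsOrbit.exists_weight`). The same argument for `t⁻¹ · y` gives a weight `m'`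
at the same fibre, now for the inverse action, so `m' = -m` (`weight_add_eq_zero`). Thus `p` has
order `n m` at `0` and `-n m` at `∞` (`exists_sectionVal_eq`), which forces it to be a monomial
(`isUnit_laurent`), and `s` vanishes nowhere on the orbit (`orbitMap_lands_nonvanishingLocus`).

The affine open `X_s` therefore contains the orbit with both its limits. A function on `X_s`
restricts to the orbit as a polynomial in `T` that is also a polynomial in `T⁻¹`, hence as a
constant, so the orbit map is constant on points (`eq_of_isAffineOpen`). This is absurd, since the
orbit is isomorphic to `𝔾ₘ`, which has at least two points.

The linearization is handled through its values `factor` at scheme-valued points, where the cocycle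
condition becomes multiplicativity. The acting element `t` and the coordinate `x` are independent:
`t` generates the field `k(t)`, and `x` is the variable of `k(t)[[x]]`. Since `t` is transcendental,
`t ^ m` determines `m` even when `k` is finite. -/

noncomputable section

namespace AlgebraicGeometry.Scheme.Modules

variable {X Y Z W : Scheme.{u}}

/-! ### Restriction of sections -/

/-- Restriction of sections of a module to a smaller open set. -/
def res (M : X.Modules) {U V : X.Opens} (h : U ≤ V) (m : Γ(M, V)) : Γ(M, U) :=
  M.presheaf.map (homOfLE h).op m

lemma res_self (M : X.Modules) {U : X.Opens} (h : U ≤ U) (m : Γ(M, U)) : M.res h m = m := by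
  simp [res]

lemma res_res (M : X.Modules) {U V W : X.Opens} (h : U ≤ V) (h' : V ≤ W) (m : Γ(M, W)) :
    M.res h (M.res h' m) = M.res (h.trans h') m := by
  have : (homOfLE (h.trans h')).op = (homOfLE h').op ≫ (homOfLE h).op := rfl
  simp [res, this]

lemma res_smul (M : X.Modules) {U V : X.Opens} (h : U ≤ V) (r : Γ(X, V)) (m : Γ(M, V)) :
    M.res h (r • m) = X.presheaf.map (homOfLE h).op r • M.res h m :=
  M.map_smul (homOfLE h) r m

lemma app_res {M N : X.Modules} (φ : M ⟶ N) {U V : X.Opens} (h : U ≤ V) (m : Γ(M, V)) :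
    φ.app U (M.res h m) = N.res h (φ.app V m) :=
  congr($(φ.mapPresheaf.naturality (homOfLE h).op) m)

/-! ### Pullback of sections -/

/-- The pullback of a section of a module along a morphism of schemes. -/
def pullSection (f : X ⟶ Y) {M : Y.Modules} {V : Y.Opens} (m : Γ(M, V)) :
    Γ((pullback f).obj M, f ⁻¹ᵁ V) :=
  ((pullbackPushforwardAdjunction f).unit.app M).app V m

lemma pullSection_res (f : X ⟶ Y) (M : Y.Modules) {U V : Y.Opens} (h : U ≤ V) (m : Γ(M, V)) :
    pullSection f (M.res h m) = res _ (f.preimage_mono h) (pullSection f m) :=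
  app_res ((pullbackPushforwardAdjunction f).unit.app M) h m

lemma pullSection_smul (f : X ⟶ Y) (M : Y.Modules) {V : Y.Opens} (r : Γ(Y, V)) (m : Γ(M, V)) :
    pullSection f (r • m) = f.app V r • pullSection f m :=
  Hom.app_smul ((pullbackPushforwardAdjunction f).unit.app M) r m

lemma pullback_map_pullSection (f : X ⟶ Y) {M N : Y.Modules} (φ : M ⟶ N) {V : Y.Opens}
    (m : Γ(M, V)) :
    ((pullback f).map φ).app _ (pullSection f m) = pullSection f (φ.app V m) :=
  congr(($((pullbackPushforwardAdjunction f).unit.naturality φ).app V) m).symm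

/-- By adjunction a morphism out of `f^* M` amounts to its effect on pulled-back sections. This
extensionality and its iterates reduce coherence of pullbacks to computations with sections. -/
lemma pullback_hom_ext (f : X ⟶ Y) {M : Y.Modules} {N : X.Modules}
    {φ ψ : (pullback f).obj M ⟶ N}
    (h : ∀ (V : Y.Opens) (m : Γ(M, V)), φ.app _ (pullSection f m) = ψ.app _ (pullSection f m)) :
    φ = ψ := by
  apply ((pullbackPushforwardAdjunction f).homEquiv _ _).injective
  rw [Adjunction.homEquiv_unit, Adjunction.homEquiv_unit]
  ext V m
  exact h V m

lemma pullback_hom_ext₂ (f : X ⟶ Y) (g : Y ⟶ Z) {M : Z.Modules} {N : X.Modules}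
    {φ ψ : (pullback f).obj ((pullback g).obj M) ⟶ N}
    (h : ∀ (V : Z.Opens) (m : Γ(M, V)), φ.app _ (pullSection f (pullSection g m)) =
      ψ.app _ (pullSection f (pullSection g m))) :
    φ = ψ := by
  apply ((pullbackPushforwardAdjunction f).homEquiv _ _).injective
  rw [Adjunction.homEquiv_unit, Adjunction.homEquiv_unit]
  apply pullback_hom_ext
  exact h

lemma pullback_hom_ext₃ (f : X ⟶ Y) (g : Y ⟶ Z) (k : Z ⟶ W) {M : W.Modules} {N : X.Modules}
    {φ ψ : (pullback f).obj ((pullback g).obj ((pullback k).obj M)) ⟶ N}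
    (h : ∀ (V : W.Opens) (m : Γ(M, V)),
      φ.app _ (pullSection f (pullSection g (pullSection k m))) =
      ψ.app _ (pullSection f (pullSection g (pullSection k m)))) :
    φ = ψ := by
  apply ((pullbackPushforwardAdjunction f).homEquiv _ _).injective
  rw [Adjunction.homEquiv_unit, Adjunction.homEquiv_unit]
  apply pullback_hom_ext₂
  exact h

/-- The inverse of `pullbackComp` is conjugate to an identification of pushforwards, hence
compatible with the adjunction units, and `pullSection` is the unit evaluated on sections. -/
lemma pullbackComp_hom_pullSection (f : X ⟶ Y) (g : Y ⟶ Z) (M : Z.Modules) {V : Z.Opens}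
    (m : Γ(M, V)) :
    ((pullbackComp f g).hom.app M).app _ (pullSection f (pullSection g m)) =
      pullSection (f ≫ g) m := by
  have h := unit_conjugateEquiv
    ((pullbackPushforwardAdjunction g).comp (pullbackPushforwardAdjunction f))
    (pullbackPushforwardAdjunction (f ≫ g)) (pullbackComp f g).inv M
  rw [conjugateEquiv_pullbackComp_inv] at h
  have h2 : pullSection f (pullSection g m) =
      ((pullbackComp f g).inv.app M).app _ (pullSection (f ≫ g) m) :=
    congr(($h).app V m)
  rw [h2]
  have h3 := congr(($((pullbackComp f g).inv_hom_id_app M)).app _ (pullSection (f ≫ g) m))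
  exact h3

end AlgebraicGeometry.Scheme.Modules

namespace AlgebraicGeometry.Scheme.Modules

variable {X Y Z W : Scheme.{u}}

/-! ### Coherence of base change -/

/-- The isomorphism `f^* g^* M ≅ h^* M` for `h = f ≫ g`. -/
def pullbackCompIso (f : X ⟶ Y) (g : Y ⟶ Z) {h : X ⟶ Z} (e : f ≫ g = h) (M : Z.Modules) :
    (pullback f).obj ((pullback g).obj M) ≅ (pullback h).obj M :=
  (pullbackComp f g).app M ≪≫ (pullbackCongr e).app M

lemma pullbackCompIso_rfl (f : X ⟶ Y) (g : Y ⟶ Z) (M : Z.Modules) :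
    pullbackCompIso f g rfl M = (pullbackComp f g).app M := by
  ext1
  simp [pullbackCompIso, pullbackCongr]

lemma pullbackCompIso_rfl_hom_pullSection (f : X ⟶ Y) (g : Y ⟶ Z) (M : Z.Modules) {V : Z.Opens}
    (m : Γ(M, V)) :
    (pullbackCompIso f g rfl M).hom.app _ (pullSection f (pullSection g m)) =
      pullSection (f ≫ g) m := by
  rw [pullbackCompIso_rfl]
  exact pullbackComp_hom_pullSection f g M m

lemma pullbackCompIso_hom_pullSection (f : X ⟶ Y) (g : Y ⟶ Z) {h : X ⟶ Z} (e : f ≫ g = h)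
    (M : Z.Modules) {V : Z.Opens} (m : Γ(M, V)) {U : X.Opens} (hU : U ≤ f ⁻¹ᵁ g ⁻¹ᵁ V)
    (hU' : U ≤ h ⁻¹ᵁ V) :
    (pullbackCompIso f g e M).hom.app U (res _ hU (pullSection f (pullSection g m))) =
      res _ hU' (pullSection h m) := by
  subst e
  rw [app_res, pullbackCompIso_rfl_hom_pullSection]
  rfl

lemma pullbackCompIso_naturality (f : X ⟶ Y) (g : Y ⟶ Z) {h : X ⟶ Z} (e : f ≫ g = h)
    {M N : Z.Modules} (φ : M ⟶ N) :
    (pullback f).map ((pullback g).map φ) ≫ (pullbackCompIso f g e N).hom =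
      (pullbackCompIso f g e M).hom ≫ (pullback h).map φ := by
  subst e
  rw [pullbackCompIso_rfl, pullbackCompIso_rfl]
  exact (pullbackComp f g).hom.naturality φ

lemma pullbackCompIso_assoc (f : X ⟶ Y) (g : Y ⟶ Z) (k : Z ⟶ W) {gk : Y ⟶ W} {fg : X ⟶ Z}
    {fgk : X ⟶ W} (e₁ : g ≫ k = gk) (e₂ : f ≫ gk = fgk) (e₃ : f ≫ g = fg) (e₄ : fg ≫ k = fgk)
    (M : W.Modules) :
    (pullback f).map (pullbackCompIso g k e₁ M).hom ≫ (pullbackCompIso f gk e₂ M).hom =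
      (pullbackCompIso f g e₃ _).hom ≫ (pullbackCompIso fg k e₄ M).hom := by
  subst e₁ e₂ e₃
  apply pullback_hom_ext₃
  intro V m
  have h1 := pullback_map_pullSection f (pullbackCompIso g k rfl M).hom
    (pullSection g (pullSection k m))
  rw [pullbackCompIso_rfl_hom_pullSection] at h1
  have h2 := pullbackCompIso_rfl_hom_pullSection f g _ (pullSection k m)
  have h3 := pullbackCompIso_rfl_hom_pullSection (f ≫ g) k M m
  have h4 := pullbackCompIso_rfl_hom_pullSection f (g ≫ k) M m
  simp only [Hom.comp_app, ConcreteCategory.comp_apply]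
  erw [h1, h4, h2, h3]
  rfl

lemma baseChangeIso_eq {L : X.Modules} {a b : Y ⟶ X}
    (Φ : (pullback a).obj L ≅ (pullback b).obj L) (f : Z ⟶ Y) {a' b' : Z ⟶ X}
    (ha : f ≫ a = a') (hb : f ≫ b = b') :
    baseChangeIso Φ f ha hb =
      (pullbackCompIso f a ha L).symm ≪≫ (pullback f).mapIso Φ ≪≫ pullbackCompIso f b hb L := by
  ext1
  simp [baseChangeIso, pullbackCompIso]

lemma pullbackCompIso_hom_baseChangeIso {L : X.Modules} {a b : Y ⟶ X}
    (Φ : (pullback a).obj L ≅ (pullback b).obj L) (f : Z ⟶ Y) {a' b' : Z ⟶ X}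
    (ha : f ≫ a = a') (hb : f ≫ b = b') :
    (pullbackCompIso f a ha L).hom ≫ (baseChangeIso Φ f ha hb).hom =
      (pullback f).map Φ.hom ≫ (pullbackCompIso f b hb L).hom := by
  simp [baseChangeIso_eq]

/-- After composing with the isomorphisms from the iterated pullbacks, only naturality and
associativity of `pullbackCompIso` are needed. This makes it possible to evaluate the cocycle
condition at points. -/
lemma baseChangeIso_baseChangeIso {L : X.Modules} {a b : Y ⟶ X}
    (Φ : (pullback a).obj L ≅ (pullback b).obj L) (f : Z ⟶ Y) {a' b' : Z ⟶ X}
    (ha : f ≫ a = a') (hb : f ≫ b = b') (g : W ⟶ Z) {a'' b'' : W ⟶ X}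
    (ha' : g ≫ a' = a'') (hb' : g ≫ b' = b'') {gf : W ⟶ Y} (h : g ≫ f = gf)
    (ha'' : gf ≫ a = a'') (hb'' : gf ≫ b = b'') :
    baseChangeIso (baseChangeIso Φ f ha hb) g ha' hb' = baseChangeIso Φ gf ha'' hb'' := by
  ext1
  rw [← cancel_epi (pullbackCompIso g a' ha' L).hom, pullbackCompIso_hom_baseChangeIso,
    ← cancel_epi ((pullback g).map (pullbackCompIso f a ha L).hom), ← Functor.map_comp_assoc,
    pullbackCompIso_hom_baseChangeIso, Functor.map_comp_assoc,
    pullbackCompIso_assoc g f b hb hb' h hb'', ← Category.assoc, pullbackCompIso_naturality,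
    ← Category.assoc ((pullback g).map _),
    pullbackCompIso_assoc g f a ha ha' h ha'', Category.assoc, Category.assoc,
    pullbackCompIso_hom_baseChangeIso]

lemma baseChangeIso_trans {L : X.Modules} {a b c : Y ⟶ X}
    (Φ : (pullback a).obj L ≅ (pullback b).obj L) (Ψ : (pullback b).obj L ≅ (pullback c).obj L)
    (f : Z ⟶ Y) {a' b' c' : Z ⟶ X}
    (ha : f ≫ a = a') (hb : f ≫ b = b') (hc : f ≫ c = c') :
    baseChangeIso (Φ ≪≫ Ψ) f ha hc = baseChangeIso Φ f ha hb ≪≫ baseChangeIso Ψ f hb hc := by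
  ext1
  simp [baseChangeIso_eq]

end AlgebraicGeometry.Scheme.Modules

namespace AlgebraicGeometry.Scheme.Modules

variable {X Y Z W : Scheme.{u}}

/-! ### Frames -/

lemma IsFrame.res {M : X.Modules} {U V : X.Opens} {s : Γ(M, U)} (hs : M.IsFrame s) (h : V ≤ U) :
    M.IsFrame (M.res h s) := by
  intro W hW
  have := hs W (hW.trans h)
  change Function.Bijective fun r : Γ(X, W) ↦ r • M.res _ s at this
  rwa [← res_res M hW h] at this

lemma IsFrame.bijective {M : X.Modules} {U : X.Opens} {s : Γ(M, U)} (hs : M.IsFrame s) :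
    Function.Bijective fun r : Γ(X, U) ↦ r • s := by
  have := hs U le_rfl
  change Function.Bijective fun r : Γ(X, U) ↦ r • M.res _ s at this
  rwa [res_self] at this

lemma IsFrame.map_iso {M N : X.Modules} {U : X.Opens} {s : Γ(M, U)} (hs : M.IsFrame s)
    (φ : M ⟶ N) [IsIso φ] : N.IsFrame (φ.app U s) := by
  intro V h
  have h1 : Function.Bijective (φ.app V) :=
    ConcreteCategory.bijective_of_isIso (φ.app V)
  convert h1.comp (hs V h) using 1
  ext r
  change r • N.res h _ = φ.app V (r • M.res h s)
  rw [Hom.app_smul, app_res]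

variable (X) in
/-- The structure sheaf as a module over itself. -/
def unitModule : X.Modules := SheafOfModules.unit X.ringCatSheaf

/-- The section `1` of the structure sheaf, as a section of the unit module. -/
def unitOne (X : Scheme.{u}) (U : X.Opens) : Γ((unitModule X), U) :=
  (1 : Γ(X, U))

lemma res_unitOne {U V : X.Opens} (h : U ≤ V) :
    res (unitModule X) h (unitOne X V) = unitOne X U :=
  map_one (X.presheaf.map (homOfLE h).op).hom

lemma isFrame_unitOne (U : X.Opens) :
    IsFrame (unitModule X) (unitOne X U) := by
  intro V h
  change Function.Bijective fun r : Γ(X, V) ↦ r • res (unitModule X) h (unitOne X U)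
  rw [res_unitOne]
  have : (fun r : Γ(X, V) ↦ r • unitOne X V) = id := funext fun r : Γ(X, V) ↦ mul_one r
  rw [this]
  exact Function.bijective_id

lemma smul_unitOne_bijective (U : X.Opens) : Function.Bijective fun r : Γ(X, U) ↦ r • unitOne X U :=
  (isFrame_unitOne U).bijective

/-- The morphism `𝒪_X ⟶ M` given by a global section of `M`. -/
def homOfSection {M : X.Modules} (s : Γ(M, ⊤)) : unitModule X ⟶ M :=
  (SheafOfModules.unitHomEquiv (R := X.ringCatSheaf) M).symm
    ⟨fun V ↦ M.res (U := V.unop) le_top s, fun {U V} i ↦ by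
      exact M.res_res (leOfHom i.unop) le_top s⟩

lemma homOfSection_unitOne {M : X.Modules} (s : Γ(M, ⊤)) (V : X.Opens) :
    (homOfSection s).app V (unitOne X V) = M.res le_top s :=
  congr(($((SheafOfModules.unitHomEquiv (R := X.ringCatSheaf) M).apply_symm_apply
    ⟨fun V ↦ M.res (U := V.unop) le_top s, fun {U V} i ↦ by
      exact M.res_res (leOfHom i.unop) le_top s⟩)).val (.op V))

lemma unitModule_hom_ext {M : X.Modules} {φ ψ : unitModule X ⟶ M}
    (h : φ.app ⊤ (unitOne X ⊤) = ψ.app ⊤ (unitOne X ⊤)) : φ = ψ := by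
  ext V m
  obtain ⟨r, rfl⟩ := (smul_unitOne_bijective V).2 m
  dsimp only
  rw [Hom.app_smul, Hom.app_smul, ← res_unitOne (X := X) le_top, app_res, app_res, h]

/-- The isomorphism `𝒪_X ≅ M` given by a global frame of `M`. -/
lemma exists_iso_of_isFrame {M : X.Modules} {s : Γ(M, ⊤)} (hs : M.IsFrame s) :
    ∃ e : unitModule X ≅ M, e.hom.app ⊤ (unitOne X ⊤) = s := by
  have : IsIso (homOfSection s) := by
    rw [Hom.isIso_iff_isIso_app]
    intro V
    rw [ConcreteCategory.isIso_iff_bijective]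
    refine (Function.Bijective.of_comp_iff _ (smul_unitOne_bijective V)).mp ?_
    convert hs V le_top using 1
    ext r
    exact (Hom.app_smul _ r _).trans (congr(r • $(homOfSection_unitOne s V)))
  exact ⟨asIso (homOfSection s), by simp [homOfSection_unitOne, res_self]⟩

/-- Every open below the image of `W` is the image of an open of `V`, and the two rings of functions
acting there correspond under `V.ι.appIso`. -/
lemma isFrame_restrict_iff {M : X.Modules} {V : X.Opens} {W : V.toScheme.Opens}
    (s : Γ(M, V.ι ''ᵁ W)) :
    IsFrame (M.restrict V.ι) (U := W) s ↔ M.IsFrame s := by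
  have key (W' : V.toScheme.Opens) (h : W' ≤ W) :
      Function.Bijective (fun r : Γ(V, W') ↦ r • (M.restrict V.ι).res h s) ↔
      Function.Bijective (fun r : Γ(X, V.ι ''ᵁ W') ↦ r • M.res (V.ι.image_mono h) s) :=
    Function.Bijective.of_comp_iff (fun r : Γ(X, V.ι ''ᵁ W') ↦ r • M.res (V.ι.image_mono h) s)
      (ConcreteCategory.bijective_of_isIso (V.ι.appIso W').inv)
  constructor
  · intro hs W₁ hW₁
    obtain ⟨W', rfl⟩ : ∃ W' : V.toScheme.Opens, W₁ = V.ι ''ᵁ W' := by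
      refine ⟨V.ι ⁻¹ᵁ W₁, ?_⟩
      rw [Scheme.Hom.image_preimage_eq_opensRange_inf, right_eq_inf]
      exact hW₁.trans (V.ι.image_le_opensRange W)
    have h : W' ≤ W := (V.ι.image_le_image_iff _ _).mp hW₁
    exact (key W' h).mp (hs W' h)
  · intro hs W' hW'
    exact (key W' hW').mpr (hs (V.ι ''ᵁ W') (V.ι.image_mono hW'))

lemma IsLineBundle.exists_isFrame {L : X.Modules} (hL : L.IsLineBundle) (x : X) :
    ∃ (U : X.Opens) (s : Γ(L, U)), x ∈ U ∧ L.IsFrame s := by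
  obtain ⟨U, hx, ⟨e⟩⟩ := hL x
  let e' : unitModule U.toScheme ≅ L.restrict U.ι := e.symm
  have h := (isFrame_unitOne (X := U) ⊤).map_iso e'.hom
  exact ⟨_, _, by simpa using hx, (isFrame_restrict_iff (M := L) _).mp h⟩

/-! ### Pullback of frames -/

/-- The structure morphism `f^* 𝒪_Y ⟶ 𝒪_X`. -/
def pullbackUnitHom (f : X ⟶ Y) : (pullback f).obj (unitModule Y) ⟶ unitModule X :=
  ((pullbackPushforwardAdjunction f).homEquiv _ _).symm
    (homOfSection (M := (pushforward f).obj (unitModule X)) (unitOne X ⊤))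

lemma pullbackUnitHom_pullSection (f : X ⟶ Y) {V : Y.Opens} (m : Γ(unitModule Y, V)) :
    (pullbackUnitHom f).app _ (pullSection f m) =
      (homOfSection (M := (pushforward f).obj (unitModule X)) (unitOne X ⊤)).app V m := by
  have := ((pullbackPushforwardAdjunction f).homEquiv _ _).apply_symm_apply
    (homOfSection (M := (pushforward f).obj (unitModule X)) (unitOne X ⊤))
  rw [Adjunction.homEquiv_unit] at this
  exact congr(($this).app V m)

lemma pullbackUnitHom_pullSection_unitOne (f : X ⟶ Y) :
    (pullbackUnitHom f).app _ (pullSection f (unitOne Y ⊤)) = unitOne X ⊤ := by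
  refine (pullbackUnitHom_pullSection f _).trans ?_
  refine (homOfSection_unitOne (M := (pushforward f).obj (unitModule X)) _ _).trans ?_
  exact res_self (M := (pushforward f).obj (unitModule X)) _ _

/-- The morphism `𝒪_X ⟶ f^* 𝒪_Y` defined by this section is inverse to `pullbackUnitHom`, so the
section is the image of the frame `1` under an isomorphism. -/
lemma isFrame_pullSection_unitOne (f : X ⟶ Y) :
    IsFrame _ (pullSection f (unitOne Y ⊤)) := by
  let d : unitModule X ⟶ (pullback f).obj (unitModule Y) := homOfSection (pullSection f (unitOne Y ⊤))
  have hd : d.app ⊤ (unitOne X ⊤) = pullSection f (unitOne Y ⊤) := by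
    refine (homOfSection_unitOne _ _).trans (res_self _ _ _)
  have h₁ : d ≫ pullbackUnitHom f = 𝟙 _ := by
    apply unitModule_hom_ext
    rw [Hom.comp_app, ConcreteCategory.comp_apply, hd]
    exact pullbackUnitHom_pullSection_unitOne f
  have h₂ : pullbackUnitHom f ≫ d = 𝟙 _ := by
    apply ((pullbackPushforwardAdjunction f).homEquiv _ _).injective
    rw [Adjunction.homEquiv_unit, Adjunction.homEquiv_unit]
    apply unitModule_hom_ext
    change d.app ⊤ ((pullbackUnitHom f).app _ (pullSection f (unitOne Y ⊤))) =
      pullSection f (unitOne Y ⊤)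
    exact congr(d.app ⊤ $(pullbackUnitHom_pullSection_unitOne f)).trans hd
  have : IsIso d := ⟨_, h₁, h₂⟩
  rw [← hd]
  exact (isFrame_unitOne ⊤).map_iso d

lemma IsFrame.pullSection_top (f : X ⟶ Y) {M : Y.Modules} {s : Γ(M, ⊤)} (hs : M.IsFrame s) :
    IsFrame _ (pullSection f s) := by
  obtain ⟨e, rfl⟩ := exists_iso_of_isFrame hs
  rw [← pullback_map_pullSection]
  exact (isFrame_pullSection_unitOne f).map_iso _

lemma restrictFunctorIsoPullback_pullSection (f : X ⟶ Y) [IsOpenImmersion f] (M : Y.Modules)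
    {V : Y.Opens} (m : Γ(M, V)) :
    ((restrictFunctorIsoPullback f).hom.app M).app (f ⁻¹ᵁ V)
      (M.res (f.image_preimage_le V) m : Γ(M, f ''ᵁ f ⁻¹ᵁ V)) = pullSection f m := by
  have := Adjunction.unit_leftAdjointUniq_hom_app (restrictAdjunction f)
    (pullbackPushforwardAdjunction f) M
  exact congr(($this).app V m)

/-- The pullback of a section over `V` along a morphism landing in `V`. -/
def pullGlobal (f : X ⟶ Y) {V : Y.Opens} (hf : ⊤ ≤ f ⁻¹ᵁ V) {M : Y.Modules} (m : Γ(M, V)) :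
    Γ((pullback f).obj M, ⊤) :=
  res _ hf (pullSection f m)

lemma pullbackCompIso_pullGlobal (f : X ⟶ Y) (g : Y ⟶ Z) {h : X ⟶ Z} (e : f ≫ g = h)
    (M : Z.Modules) {V : Z.Opens} (m : Γ(M, V)) (hg : ⊤ ≤ g ⁻¹ᵁ V) (hh : ⊤ ≤ h ⁻¹ᵁ V) :
    (pullbackCompIso f g e M).hom.app ⊤ (pullSection f (pullGlobal g hg m)) =
      pullGlobal h hh m := by
  rw [pullGlobal, pullSection_res]
  exact pullbackCompIso_hom_pullSection f g e M m _ hh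

/-- The morphism factors through the open `V`. Pullback to `V` is restriction, where the frame
becomes global, and global frames pull back to frames. -/
lemma IsFrame.pullGlobal {M : Y.Modules} {V : Y.Opens} {m : Γ(M, V)} (hm : M.IsFrame m)
    (f : X ⟶ Y) (hf : ⊤ ≤ f ⁻¹ᵁ V) : IsFrame _ (pullGlobal f hf m) := by
  have hr : Set.range f ⊆ Set.range V.ι := by
    rintro _ ⟨x, rfl⟩
    simpa using hf (show x ∈ (⊤ : X.Opens) from trivial)
  let f' := IsOpenImmersion.lift V.ι f hr
  have hf' : f' ≫ V.ι = f := IsOpenImmersion.lift_fac _ _ _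
  have hV : ⊤ ≤ V.ι ⁻¹ᵁ V := fun x _ ↦ x.2
  have h1 : IsFrame _ (Modules.pullGlobal V.ι hV m) := by
    have h2 := ((isFrame_restrict_iff (M := M) (W := V.ι ⁻¹ᵁ V)
      (M.res (V.ι.image_preimage_le V) m)).mpr (hm.res _)).map_iso
      ((restrictFunctorIsoPullback V.ι).hom.app M)
    rw [restrictFunctorIsoPullback_pullSection] at h2
    exact h2.res hV
  rw [← pullbackCompIso_pullGlobal f' V.ι hf' M m hV hf]
  exact (h1.pullSection_top f').map_iso _

end AlgebraicGeometry.Scheme.Modules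

/-! ### Gluing of functions and a local criterion for frames -/

namespace AlgebraicGeometry.Scheme

/-- Restriction of functions to a smaller open set. -/
def resFun (X : Scheme.{u}) {U V : X.Opens} (h : U ≤ V) : Γ(X, V) →+* Γ(X, U) :=
  (X.presheaf.map (homOfLE h).op).hom

lemma resFun_self (X : Scheme.{u}) {U : X.Opens} (h : U ≤ U) (r : Γ(X, U)) :
    X.resFun h r = r := by
  simp [resFun]

lemma resFun_resFun (X : Scheme.{u}) {U V W : X.Opens} (h : U ≤ V) (h' : V ≤ W) (r : Γ(X, W)) :
    X.resFun h (X.resFun h' r) = X.resFun (h.trans h') r := by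
  have : (homOfLE (h.trans h')).op = (homOfLE h').op ≫ (homOfLE h).op := rfl
  simp [resFun, this]

lemma exists_glue (X : Scheme.{u}) {I : Type u} (U : I → X.Opens) (V : X.Opens) (hUV : ∀ i, U i ≤ V)
    (hV : V ≤ ⨆ i, U i) (r : ∀ i, Γ(X, U i))
    (hr : ∀ i j, X.resFun (inf_le_left : U i ⊓ U j ≤ U i) (r i) =
      X.resFun (inf_le_right : U i ⊓ U j ≤ U j) (r j)) :
    ∃ s : Γ(X, V), ∀ i, X.resFun (hUV i) s = r i := by
  obtain ⟨s, hs, -⟩ := X.sheaf.existsUnique_gluing' U V (fun i ↦ homOfLE (hUV i)) hV r hr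
  exact ⟨s, hs⟩

lemma eq_of_locally_eq (X : Scheme.{u}) {V : X.Opens} (r r' : Γ(X, V))
    (h : ∀ x ∈ V, ∃ (W : X.Opens) (hW : W ≤ V), x ∈ W ∧ X.resFun hW r = X.resFun hW r') :
    r = r' := by
  choose! W hW hx h using h
  refine X.sheaf.eq_of_locally_eq' (fun x : V ↦ W x) V (fun x ↦ homOfLE (hW x x.2))
    (fun x hxV ↦ ?_) r r' fun x ↦ h x x.2
  exact TopologicalSpace.Opens.mem_iSup.mpr ⟨⟨x, hxV⟩, hx x hxV⟩

namespace Modules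

variable {X Y Z W : Scheme.{u}}

lemma res_smul' (M : X.Modules) {U V : X.Opens} (h : U ≤ V) (r : Γ(X, V)) (m : Γ(M, V)) :
    M.res h (r • m) = X.resFun h r • M.res h m :=
  res_smul M h r m

lemma eq_of_locally_eq (M : X.Modules) {V : X.Opens} (m m' : Γ(M, V))
    (h : ∀ x ∈ V, ∃ (W : X.Opens) (hW : W ≤ V), x ∈ W ∧ M.res hW m = M.res hW m') :
    m = m' := by
  choose! W hW hx h using h
  let F : TopCat.Sheaf Ab X := ⟨M.presheaf, M.isSheaf⟩
  refine F.eq_of_locally_eq' (fun x : V ↦ W x) V (fun x ↦ homOfLE (hW x x.2))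
    (fun x hxV ↦ ?_) m m' fun x ↦ h x x.2
  exact TopologicalSpace.Opens.mem_iSup.mpr ⟨⟨x, hxV⟩, hx x hxV⟩

/-- Uniqueness of coefficients on all smaller opens makes locally found coefficients agree on
overlaps, so they glue. -/
lemma isFrame_of_locally {M : X.Modules} {U : X.Opens} (t : Γ(M, U))
    (hinj : ∀ (V : X.Opens) (h : V ≤ U) (r r' : Γ(X, V)), r • M.res h t = r' • M.res h t → r = r')
    (hsurj : ∀ (V : X.Opens) (h : V ≤ U) (m : Γ(M, V)), ∀ x ∈ V, ∃ (W : X.Opens) (hW : W ≤ V),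
      x ∈ W ∧ ∃ r : Γ(X, W), r • M.res (hW.trans h) t = M.res hW m) :
    M.IsFrame t := by
  refine fun V hV ↦ ⟨fun r r' h ↦ hinj V hV r r' h, fun m ↦ ?_⟩
  choose! W hW hx r hr using hsurj V hV m
  obtain ⟨s, hs⟩ := X.exists_glue (fun x : V ↦ W x) V (fun x ↦ hW x x.2)
    (fun x hxV ↦ TopologicalSpace.Opens.mem_iSup.mpr ⟨⟨x, hxV⟩, hx x hxV⟩)
    (fun x ↦ r x) (fun x y ↦ by
      apply hinj _ (inf_le_left.trans ((hW x x.2).trans hV))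
      have h1 := congr(M.res (inf_le_left : W x ⊓ W y ≤ W x) $(hr x x.2))
      have h2 := congr(M.res (inf_le_right : W x ⊓ W y ≤ W y) $(hr y y.2))
      rw [res_smul', res_res, res_res] at h1 h2
      exact h1.trans h2.symm)
  refine ⟨s, eq_of_locally_eq M _ _ fun x hxV ↦ ⟨W x, hW x hxV, hx x hxV, ?_⟩⟩
  change M.res _ (s • M.res hV t) = _
  rw [res_smul', res_res]
  exact congr($(hs ⟨x, hxV⟩) • M.res _ t).trans (hr x hxV)

/-! ### Tensor products of sections -/

section tensor

variable (M N : X.Modules)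

/-- The presheaf tensor product. -/
abbrev tensorPresheaf : _root_.PresheafOfModules X.ringCatSheaf.obj :=
  PresheafOfModules.Monoidal.tensorObj (R := X.presheaf) M.val N.val

/-- The canonical map from the presheaf tensor product to the tensor product. -/
def toTensor (U : X.Opens) : (tensorPresheaf M N).obj (.op U) →ₗ[Γ(X, U)] Γ(tensor M N, U) where
  toFun t := ((PresheafOfModules.sheafificationAdjunction (𝟙 X.ringCatSheaf.obj)).unit.app
      (tensorPresheaf M N)).app (.op U) t
  map_add' _ _ := map_add _ _ _
  map_smul' r t := (((PresheafOfModules.sheafificationAdjunction (𝟙 X.ringCatSheaf.obj)).unit.app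
      (tensorPresheaf M N)).app (.op U)).hom.map_smul r t

variable {M N}

/-- The tensor product of two sections. -/
def tmul {U : X.Opens} (m : Γ(M, U)) (n : Γ(N, U)) : Γ(tensor M N, U) :=
  toTensor M N U (TensorProduct.tmul Γ(X, U) (M := Γ(M, U)) (N := Γ(N, U)) m n)

lemma tmul_smul_smul {U : X.Opens} (r r' : Γ(X, U)) (m : Γ(M, U)) (n : Γ(N, U)) :
    tmul (r • m) (r' • n) = (r * r') • tmul m n := by
  refine Eq.trans ?_ ((toTensor M N U).map_smul (r * r') _)
  exact congr(toTensor M N U $(TensorProduct.smul_tmul_smul r r' m n))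

variable (M N) in
/-- Restriction in the presheaf tensor product. -/
def tensorRes {U V : X.Opens} (h : U ≤ V) (t : (tensorPresheaf M N).obj (.op V)) :
    (tensorPresheaf M N).obj (.op U) :=
  (tensorPresheaf M N).presheaf.map (homOfLE h).op t

lemma tensorRes_smul_tmul {U V : X.Opens} (h : U ≤ V) (r : Γ(X, V)) (m : Γ(M, V)) (n : Γ(N, V)) :
    tensorRes M N h (r • TensorProduct.tmul Γ(X, V) (M := Γ(M, V)) (N := Γ(N, V)) m n :
      TensorProduct Γ(X, V) Γ(M, V) Γ(N, V)) =
    (X.resFun h r • TensorProduct.tmul Γ(X, U) (M := Γ(M, U)) (N := Γ(N, U))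
      (M.res h m) (N.res h n) : TensorProduct Γ(X, U) Γ(M, U) Γ(N, U)) :=
  (tensorPresheaf M N).map_smul (homOfLE h).op r
    (TensorProduct.tmul Γ(X, V) (M := Γ(M, V)) (N := Γ(N, V)) m n)

lemma res_toTensor {U V : X.Opens} (h : U ≤ V) (t : (tensorPresheaf M N).obj (.op V)) :
    res _ h (toTensor M N V t) = toTensor M N U (tensorRes M N h t) :=
  congr($((CategoryTheory.toSheafify (Opens.grothendieckTopology X)
    (tensorPresheaf M N).presheaf).naturality (homOfLE h).op) t).symm

lemma res_tmul {U V : X.Opens} (h : U ≤ V) (m : Γ(M, V)) (n : Γ(N, V)) :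
    res _ h (tmul m n) = tmul (M.res h m) (N.res h n) := by
  exact res_toTensor h _

lemma toTensor_locally_injective {U : X.Opens} {a b : (tensorPresheaf M N).obj (.op U)}
    (h : toTensor M N U a = toTensor M N U b) (x : X) (hx : x ∈ U) :
    ∃ (W : X.Opens) (hW : W ≤ U), x ∈ W ∧ tensorRes M N hW a = tensorRes M N hW b := by
  obtain ⟨W, f, hf, hxW⟩ := Presheaf.equalizerSieve_mem (Opens.grothendieckTopology X)
    (CategoryTheory.toSheafify (Opens.grothendieckTopology X) (tensorPresheaf M N).presheaf)
    (X := .op U) a b h x hx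
  exact ⟨W, leOfHom f, hxW, hf⟩

lemma toTensor_locally_surjective {U : X.Opens} (t : Γ(tensor M N, U)) (x : X) (hx : x ∈ U) :
    ∃ (W : X.Opens) (hW : W ≤ U), x ∈ W ∧ ∃ a, toTensor M N W a = res _ hW t := by
  obtain ⟨W, f, ⟨a, ha⟩, hxW⟩ := Presheaf.imageSieve_mem (Opens.grothendieckTopology X)
    (CategoryTheory.toSheafify (Opens.grothendieckTopology X) (tensorPresheaf M N).presheaf)
    (U := .op U) t x hx
  exact ⟨W, leOfHom f, hxW, a, ha⟩

lemma tmul_bijective {R A B : Type u} [CommRing R] [AddCommGroup A] [AddCommGroup B] [Module R A]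
    [Module R B] {m : A} {n : B} (hm : Function.Bijective fun r : R ↦ r • m)
    (hn : Function.Bijective fun r : R ↦ r • n) :
    Function.Bijective fun r : R ↦ r • TensorProduct.tmul R m n := by
  let e₁ : R ≃ₗ[R] A := LinearEquiv.ofBijective (LinearMap.toSpanSingleton R A m) hm
  let e₂ : R ≃ₗ[R] B := LinearEquiv.ofBijective (LinearMap.toSpanSingleton R B n) hn
  convert ((TensorProduct.lid R R).symm ≪≫ₗ TensorProduct.congr e₁ e₂).bijective using 1
  ext r
  have h₁ : e₁ 1 = m := one_smul R m
  have h₂ : e₂ r = r • n := rfl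
  simp [h₁, h₂]

/-- For the presheaf tensor product this is `tmul_bijective`. The map to the sheafification is only
locally injective and locally surjective, which suffices for `isFrame_of_locally`. -/
lemma IsFrame.tmul {U : X.Opens} {m : Γ(M, U)} {n : Γ(N, U)} (hm : M.IsFrame m)
    (hn : N.IsFrame n) : IsFrame _ (tmul m n) := by
  have key (V : X.Opens) (h : V ≤ U) : Function.Bijective fun r : Γ(X, V) ↦
      (r • TensorProduct.tmul Γ(X, V) (M := Γ(M, V)) (N := Γ(N, V)) (M.res h m) (N.res h n) :
      TensorProduct Γ(X, V) Γ(M, V) Γ(N, V)) :=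
    tmul_bijective (R := Γ(X, V)) (A := Γ(M, V)) (B := Γ(N, V)) (hm V h) (hn V h)
  have tmul_eq (V : X.Opens) (h : V ≤ U) (r : Γ(X, V)) : r • Modules.res _ h (Modules.tmul m n) =
      toTensor M N V (r • TensorProduct.tmul Γ(X, V) (M := Γ(M, V)) (N := Γ(N, V))
        (M.res h m) (N.res h n) : TensorProduct Γ(X, V) Γ(M, V) Γ(N, V)) := by
    rw [res_tmul]
    exact ((toTensor M N V).map_smul r _).symm
  apply isFrame_of_locally
  · intro V hV r r' h
    rw [tmul_eq, tmul_eq] at h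
    refine Scheme.eq_of_locally_eq X _ _ fun x hx ↦ ?_
    obtain ⟨W, hW, hxW, h⟩ := toTensor_locally_injective h x hx
    refine ⟨W, hW, hxW, (key W (hW.trans hV)).1 ?_⟩
    rw [tensorRes_smul_tmul, tensorRes_smul_tmul, res_res, res_res] at h
    exact h
  · intro V hV t x hx
    obtain ⟨W, hW, hxW, a, ha⟩ := toTensor_locally_surjective t x hx
    obtain ⟨r, rfl⟩ := (key W (hW.trans hV)).2 a
    exact ⟨W, hW, hxW, r, (tmul_eq _ _ _).trans ha⟩

end tensor

/-! ### Tensor powers of sections -/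

/-- The tensor powers of a section. -/
def powSection {L : X.Modules} {U : X.Opens} (m : Γ(L, U)) : ∀ n : ℕ, Γ(L.tensorPow n, U)
  | 0 => unitOne X U
  | n + 1 => tmul (powSection m n) m

lemma IsFrame.powSection {L : X.Modules} {U : X.Opens} {m : Γ(L, U)} (hm : L.IsFrame m) :
    ∀ n, IsFrame _ (powSection m n)
  | 0 => isFrame_unitOne U
  | n + 1 => (IsFrame.powSection hm n).tmul hm

lemma res_powSection {L : X.Modules} {U V : X.Opens} (h : U ≤ V) (m : Γ(L, V)) :
    ∀ n, res _ h (powSection m n) = powSection (L.res h m) n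
  | 0 => res_unitOne h
  | n + 1 => by
    change res _ h (tmul _ _) = tmul _ _
    rw [res_tmul, res_powSection h m n]

lemma powSection_smul {L : X.Modules} {U : X.Opens} (r : Γ(X, U)) (m : Γ(L, U)) :
    ∀ n, powSection (r • m) n = r ^ n • powSection m n
  | 0 => by
    rw [pow_zero]
    exact (one_smul _ _).symm
  | n + 1 => by
    change tmul _ _ = r ^ (n + 1) • tmul _ _
    rw [powSection_smul r m n, tmul_smul_smul, pow_succ]
    rfl

/-! ### Nonvanishing loci -/

lemma isFrame_smul_iff {M : X.Modules} {U : X.Opens} {m : Γ(M, U)} (hm : M.IsFrame m)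
    (r : Γ(X, U)) : M.IsFrame (r • m) ↔ IsUnit r := by
  constructor
  · intro h
    obtain ⟨r', hr'⟩ := h.bijective.2 m
    refine .of_mul_eq_one_right r' (hm.bijective.1 ?_)
    simpa [mul_smul] using hr'
  · intro h V hV
    have h2 : IsUnit (X.resFun hV r) := h.map _
    have h3 : Function.Bijective fun r' : Γ(X, V) ↦ r' * X.resFun hV r :=
      IsUnit.isUnit_iff_mulRight_bijective.mp h2
    convert (hm V hV).comp h3 using 1
    ext r'
    change r' • M.res hV (r • m) = (r' * X.resFun hV r) • M.res hV m
    rw [res_smul', mul_smul]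

lemma mem_nonvanishingLocus_iff {M : X.Modules} {U : X.Opens} {m : Γ(M, U)} (hm : M.IsFrame m)
    {s : Γ(M, ⊤)} {r : Γ(X, U)} (hr : M.res le_top s = r • m) {x : X} (hx : x ∈ U) :
    x ∈ M.nonvanishingLocus s ↔ x ∈ X.basicOpen r := by
  constructor
  · intro h
    obtain ⟨V, hV, hxV⟩ := TopologicalSpace.Opens.mem_sSup.mp h
    have h1 : M.IsFrame (M.res inf_le_left (M.res (U := V) le_top s) : Γ(M, V ⊓ U)) :=
      IsFrame.res hV inf_le_left
    have h2 : (M.res inf_le_left (M.res (U := V) le_top s) : Γ(M, V ⊓ U)) =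
        X.resFun (inf_le_right : V ⊓ U ≤ U) r • M.res inf_le_right m := by
      rw [res_res, ← res_smul', ← hr, res_res]
    rw [h2, isFrame_smul_iff (hm.res _)] at h1
    have h3 : X.basicOpen (X.resFun (inf_le_right : V ⊓ U ≤ U) r) = V ⊓ U :=
      X.basicOpen_of_isUnit h1
    have h4 : x ∈ X.basicOpen (X.resFun (inf_le_right : V ⊓ U ≤ U) r) := by
      rw [h3]; exact ⟨hxV, hx⟩
    erw [X.basicOpen_res] at h4
    exact h4.2
  · intro h
    refine TopologicalSpace.Opens.mem_sSup.mpr ⟨X.basicOpen r, ?_, h⟩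
    change M.IsFrame (M.res le_top s)
    rw [← res_res M (X.basicOpen_le r) le_top, hr, res_smul', isFrame_smul_iff (hm.res _)]
    exact RingedSpace.isUnit_res_basicOpen _ r

end Modules
end AlgebraicGeometry.Scheme

namespace AlgebraicGeometry.Scheme

variable {X Y Z : Scheme.{u}}

/-! ### Values of functions at scheme-valued points -/

/-- The value of a function `r` on `V` at a point `f : X ⟶ Y` landing in `V`. -/
def evalAt (f : X ⟶ Y) {V : Y.Opens} (hf : ⊤ ≤ f ⁻¹ᵁ V) : Γ(Y, V) →+* Γ(X, ⊤) :=
  (X.resFun hf).comp (f.app V).hom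

lemma evalAt_resFun (f : X ⟶ Y) {U V : Y.Opens} (h : U ≤ V) (hf : ⊤ ≤ f ⁻¹ᵁ U)
    (hf' : ⊤ ≤ f ⁻¹ᵁ V) (r : Γ(Y, V)) : evalAt f hf (Y.resFun h r) = evalAt f hf' r := by
  have := congr(X.resFun hf ($(f.naturality (homOfLE h).op) r))
  exact this.trans (resFun_resFun X hf _ _)

lemma appTop_evalAt (f : X ⟶ Y) (g : Y ⟶ Z) {h : X ⟶ Z} (e : f ≫ g = h) {V : Z.Opens}
    (hg : ⊤ ≤ g ⁻¹ᵁ V) (hh : ⊤ ≤ h ⁻¹ᵁ V) (r : Γ(Z, V)) :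
    f.appTop (evalAt g hg r) = evalAt h hh r := by
  subst e
  exact congr($(f.naturality (homOfLE hg).op) (g.app V r))

lemma evalAt_top (f : X ⟶ Y) (r : Γ(Y, ⊤)) : evalAt f (V := ⊤) le_rfl r = f.appTop r :=
  resFun_self X _ _

lemma comp_mem_of_mem (f : X ⟶ Y) (g : Y ⟶ Z) {h : X ⟶ Z} (e : f ≫ g = h) {V : Z.Opens}
    (hg : ⊤ ≤ g ⁻¹ᵁ V) : ⊤ ≤ h ⁻¹ᵁ V := by
  subst e
  intro x _
  exact hg (show f x ∈ (⊤ : Y.Opens) from trivial)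

namespace Modules

lemma pullGlobal_res (f : X ⟶ Y) (M : Y.Modules) {U V : Y.Opens} (h : U ≤ V) (hf : ⊤ ≤ f ⁻¹ᵁ U)
    (hf' : ⊤ ≤ f ⁻¹ᵁ V) (m : Γ(M, V)) : pullGlobal f hf (M.res h m) = pullGlobal f hf' m := by
  rw [pullGlobal, pullSection_res, res_res]
  rfl

lemma pullGlobal_smul (f : X ⟶ Y) (M : Y.Modules) {V : Y.Opens} (hf : ⊤ ≤ f ⁻¹ᵁ V)
    (r : Γ(Y, V)) (m : Γ(M, V)) : pullGlobal f hf (r • m) = evalAt f hf r • pullGlobal f hf m := by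
  rw [pullGlobal, pullSection_smul, res_smul']
  rfl

/-- A frame of a module on an open set. -/
structure LocalFrame (L : X.Modules) where
  /-- The open set on which the frame is defined. -/
  opens : X.Opens
  /-- The section. -/
  sec : Γ(L, opens)
  isFrame : L.IsFrame sec

/-- A point `f : Y ⟶ X` lands in the domain of a local frame. -/
abbrev LocalFrame.Lands {L : X.Modules} (b : L.LocalFrame) (f : Y ⟶ X) : Prop :=
  ⊤ ≤ f ⁻¹ᵁ b.opens

/-- The frame of `f^* L` induced by a local frame of `L` at a point `f` landing in its domain. -/
def LocalFrame.at {L : X.Modules} (b : L.LocalFrame) (f : Y ⟶ X) (hf : b.Lands f) :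
    Γ((pullback f).obj L, ⊤) :=
  pullGlobal f hf b.sec

lemma LocalFrame.isFrame_at {L : X.Modules} (b : L.LocalFrame) (f : Y ⟶ X) (hf : b.Lands f) :
    IsFrame _ (b.at f hf) :=
  b.isFrame.pullGlobal f hf

lemma LocalFrame.Lands.comp {L : X.Modules} {b : L.LocalFrame} {f : Y ⟶ X} (hf : b.Lands f)
    (g : Z ⟶ Y) {h : Z ⟶ X} (e : g ≫ f = h) : b.Lands h :=
  comp_mem_of_mem g f e hf

lemma trans_hom_app_eq_smul {M N K : X.Modules} {A : M ≅ N} {B : N ≅ K} {C : M ≅ K}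
    (hC : C = A ≪≫ B) {U : X.Opens} {m : Γ(M, U)} {n : Γ(N, U)} {k : Γ(K, U)} {r r' : Γ(X, U)}
    (h₁ : r • n = A.hom.app U m) (h₂ : r' • k = B.hom.app U n) :
    (r * r') • k = C.hom.app U m := by
  subst hC
  rw [Iso.trans_hom, Modules.Hom.comp_app, ConcreteCategory.comp_apply, ← h₁,
    Modules.Hom.app_smul, ← h₂, mul_smul]

lemma baseChangeIso_app_eq_smul {L : X.Modules} {a b : Y ⟶ X}
    (Φ : (pullback a).obj L ≅ (pullback b).obj L) (f : Z ⟶ Y) {a' b' : Z ⟶ X}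
    (ha : f ≫ a = a') (hb : f ≫ b = b') {C : (pullback a').obj L ≅ (pullback b').obj L}
    (hC : baseChangeIso Φ f ha hb = C) {s t : L.LocalFrame}
    (hs : s.Lands a) (ht : t.Lands b) (hs' : s.Lands a') (ht' : t.Lands b') {r : Γ(Y, ⊤)}
    (h : r • t.at b ht = Φ.hom.app ⊤ (s.at a hs)) :
    f.appTop r • t.at b' ht' = C.hom.app ⊤ (s.at a' hs') := by
  subst hC
  have h2 : (pullbackCompIso f b hb L).hom.app ⊤ (pullSection f (t.at b ht)) = t.at b' ht' :=
    pullbackCompIso_pullGlobal f b hb L t.sec ht ht'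
  have h1 : (pullbackCompIso f a ha L).hom.app ⊤ (pullSection f (s.at a hs)) = s.at a' hs' :=
    pullbackCompIso_pullGlobal f a ha L s.sec hs hs'
  rw [← h1, ← h2]
  have h3 := congr(($(pullbackCompIso_hom_baseChangeIso Φ f ha hb)).app ⊤
    (pullSection f (s.at a hs)))
  refine Eq.trans ?_ h3.symm
  have h4 := pullback_map_pullSection f Φ.hom (s.at a hs)
  rw [← h, pullSection_smul] at h4
  refine Eq.trans ?_ congr((pullbackCompIso f b hb L).hom.app ⊤ $(h4.symm))
  exact (Modules.Hom.app_smul _ _ _).symm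

lemma app_eq_smul_of_res_eq_smul {L : X.Modules} {N : Y.Modules} (f : Y ⟶ X)
    (φ : (pullback f).obj L ⟶ N) {b c : L.LocalFrame} (hb : b.Lands f) (hc : c.Lands f)
    {V : X.Opens} (h₁ : V ≤ b.opens) (h₂ : V ≤ c.opens) (hV : ⊤ ≤ f ⁻¹ᵁ V) {r : Γ(X, V)}
    (hr : L.res h₁ b.sec = r • L.res h₂ c.sec) {r' : Γ(Y, ⊤)} {n : Γ(N, ⊤)}
    (h : r' • n = φ.app ⊤ (c.at f hc)) :
    (evalAt f hV r * r') • n = φ.app ⊤ (b.at f hb) := by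
  rw [mul_smul, h, ← Modules.Hom.app_smul, LocalFrame.at, LocalFrame.at,
    ← pullGlobal_res f L h₂ hV, ← pullGlobal_smul, ← hr, pullGlobal_res f L h₁ hV hb]

end Modules

end AlgebraicGeometry.Scheme

open AlgebraicGeometry.Scheme AlgebraicGeometry.Scheme.Modules

namespace Linearization

variable {S : Scheme.{u}} {G : Over S} [GrpObj G] {Y : Over S} [ModObj G Y]
  {L : Y.left.Modules} (Φ : Linearization G Y L) {T T' : Over S}

/-! ### The linearization at scheme-valued points -/

/-- The isomorphism `w^* L ≅ x^* L` for points `g` of `G` and `x`, `w` of `Y` with `g • x = w`. -/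
def isoAt (g : T ⟶ G) (x : T ⟶ Y) {w : T ⟶ Y} (hw : g • x = w) :
    (Modules.pullback w.left).obj L ≅ (Modules.pullback x.left).obj L :=
  baseChangeIso Φ.iso (lift g x).left
    (by rw [← Over.comp_left, ← hw]; rfl)
    (by rw [← Over.comp_left, lift_snd])

lemma baseChangeIso_isoAt (f : T' ⟶ T) (g : T ⟶ G) (x : T ⟶ Y) {w : T ⟶ Y} (hw : g • x = w)
    {g' : T' ⟶ G} {x' w' : T' ⟶ Y} (hg : f ≫ g = g') (hx : f ≫ x = x') (hfw : f ≫ w = w')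
    (hw' : g' • x' = w') :
    baseChangeIso (Φ.isoAt g x hw) f.left
      (by rw [← Over.comp_left, hfw]) (by rw [← Over.comp_left, hx]) = Φ.isoAt g' x' hw' := by
  refine baseChangeIso_baseChangeIso _ _ _ _ _ _ _ ?_ _ _
  rw [← Over.comp_left, comp_lift, hg, hx]

/-- This is the cocycle condition pulled back along the point `(g, h, x)` of `G × G × Y`. The three
base changes become those along `(g h, x)`, `(g, h x)` and `(h, x)`. -/
lemma isoAt_mul (g h : T ⟶ G) (x : T ⟶ Y) {w v : T ⟶ Y} (hw : h • x = w) (hv : g • w = v)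
    (hgh : (g * h) • x = v) :
    Φ.isoAt (g * h) x hgh = Φ.isoAt g w hv ≪≫ Φ.isoAt h x hw := by
  have h1 : lift (lift g h) x ≫ (α_ G G Y).hom ≫ G ◁ γ[G, Y] ≫ γ[G, Y] = v := by
    rw [← hv, ← hw]
    simp [Hom.smul_def]
  have h2 : lift (lift g h) x ≫ (α_ G G Y).hom ≫ snd G (G ⊗ Y) ≫ γ[G, Y] = w := by
    rw [← hw]
    simp [Hom.smul_def]
  have h3 : lift (lift g h) x ≫ (α_ G G Y).hom ≫ snd G (G ⊗ Y) ≫ snd G Y = x := by simp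
  have key := congr(baseChangeIso $(Φ.cocycle) (lift (lift g h) x).left (a' := v.left)
    (b' := x.left) (by rw [← Over.comp_left, h1]) (by rw [← Over.comp_left, h3]))
  rw [baseChangeIso_trans _ _ _ _ (b' := w.left) (by rw [← Over.comp_left, h2]) _] at key
  have e1 : (lift (lift g h) x).left ≫ (μ[G] ▷ Y).left = (lift (g * h) x).left := by
    rw [← Over.comp_left]
    congr 1
    ext1 <;> simp [Hom.mul_def]
  have e2 : (lift (lift g h) x).left ≫ ((α_ G G Y).hom ≫ G ◁ γ[G, Y]).left = (lift g w).left := by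
    rw [← Over.comp_left]
    congr 1
    ext1 <;> simp [← hw, Hom.smul_def]
  have e3 : (lift (lift g h) x).left ≫ ((α_ G G Y).hom ≫ snd G (G ⊗ Y)).left =
      (lift h x).left := by
    rw [← Over.comp_left]
    congr 1
    ext1 <;> simp
  exact (baseChangeIso_baseChangeIso _ _ _ _ _ _ _ e1 _ _).symm.trans (key.trans
    (congrArg₂ (fun A B ↦ A ≪≫ B) (baseChangeIso_baseChangeIso _ _ _ _ _ _ _ e2 _ _)
      (baseChangeIso_baseChangeIso _ _ _ _ _ _ _ e3 _ _)))

/-- The linearization at points `g` and `x`, as a function in terms of local frames. -/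
def factor (g : T ⟶ G) (x : T ⟶ Y) {w : T ⟶ Y} (hw : g • x = w) {b b' : L.LocalFrame}
    (hb : b.Lands w.left) (hb' : b'.Lands x.left) : Γ(T.left, ⊤) :=
  ((b'.isFrame_at x.left hb').bijective.2
    ((Φ.isoAt g x hw).hom.app ⊤ (b.at w.left hb))).choose

lemma factor_smul (g : T ⟶ G) (x : T ⟶ Y) {w : T ⟶ Y} (hw : g • x = w) {b b' : L.LocalFrame}
    (hb : b.Lands w.left) (hb' : b'.Lands x.left) :
    Φ.factor g x hw hb hb' • b'.at x.left hb' =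
      (Φ.isoAt g x hw).hom.app ⊤ (b.at w.left hb) :=
  ((b'.isFrame_at x.left hb').bijective.2
    ((Φ.isoAt g x hw).hom.app ⊤ (b.at w.left hb))).choose_spec

lemma factor_eq (g : T ⟶ G) (x : T ⟶ Y) {w : T ⟶ Y} (hw : g • x = w) {b b' : L.LocalFrame}
    (hb : b.Lands w.left) (hb' : b'.Lands x.left) (r : Γ(T.left, ⊤))
    (hr : r • b'.at x.left hb' =
      (Φ.isoAt g x hw).hom.app ⊤ (b.at w.left hb)) :
    Φ.factor g x hw hb hb' = r :=
  (b'.isFrame_at x.left hb').bijective.1 ((Φ.factor_smul g x hw hb hb').trans hr.symm)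

lemma isUnit_factor (g : T ⟶ G) (x : T ⟶ Y) {w : T ⟶ Y} (hw : g • x = w) {b b' : L.LocalFrame}
    (hb : b.Lands w.left) (hb' : b'.Lands x.left) : IsUnit (Φ.factor g x hw hb hb') := by
  rw [← isFrame_smul_iff (b'.isFrame_at x.left hb'), factor_smul]
  exact (b.isFrame_at w.left hb).map_iso _

lemma factor_mul (g h : T ⟶ G) (x : T ⟶ Y) {w v : T ⟶ Y} (hw : h • x = w) (hv : g • w = v)
    (hgh : (g * h) • x = v) {b b' b'' : L.LocalFrame}
    (hb : b.Lands v.left) (hb' : b'.Lands w.left) (hb'' : b''.Lands x.left) :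
    Φ.factor (g * h) x hgh hb hb'' = Φ.factor g w hv hb hb' * Φ.factor h x hw hb' hb'' := by
  exact factor_eq _ _ _ _ _ _ _ (trans_hom_app_eq_smul (isoAt_mul Φ g h x hw hv hgh)
    (factor_smul Φ g w hv hb hb') (factor_smul Φ h x hw hb' hb''))

lemma appTop_factor (f : T' ⟶ T) (g : T ⟶ G) (x : T ⟶ Y) {w : T ⟶ Y} (hw : g • x = w)
    {g' : T' ⟶ G} {x' w' : T' ⟶ Y} (hg : f ≫ g = g') (hx : f ≫ x = x') (hfw : f ≫ w = w')
    (hw' : g' • x' = w') {b b' : L.LocalFrame} (hb : b.Lands w.left) (hb' : b'.Lands x.left)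
    (hb₁ : b.Lands w'.left) (hb₁' : b'.Lands x'.left) :
    f.left.appTop (Φ.factor g x hw hb hb') = Φ.factor g' x' hw' hb₁ hb₁' := by
  exact (factor_eq _ _ _ _ _ _ _ (baseChangeIso_app_eq_smul _ f.left _ _
    (Φ.baseChangeIso_isoAt f g x hw hg hx hfw hw') hb hb' hb₁ hb₁'
    (factor_smul Φ g x hw hb hb'))).symm

lemma factor_change (g : T ⟶ G) (x : T ⟶ Y) {w : T ⟶ Y} (hw : g • x = w) {b c b' : L.LocalFrame}
    (hb : b.Lands w.left) (hc : c.Lands w.left) (hb' : b'.Lands x.left) {V : Y.left.Opens}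
    (h₁ : V ≤ b.opens) (h₂ : V ≤ c.opens) (hV : ⊤ ≤ w.left ⁻¹ᵁ V) (r : Γ(Y.left, V))
    (hr : L.res h₁ b.sec = r • L.res h₂ c.sec) :
    Φ.factor g x hw hb hb' = evalAt w.left hV r * Φ.factor g x hw hc hb' := by
  exact factor_eq _ _ _ _ _ _ _ (app_eq_smul_of_res_eq_smul _ _ hb hc h₁ h₂ hV hr
    (factor_smul Φ g x hw hc hb'))

end Linearization

/-! ### Affine points of the multiplicative group and of the affine line -/

section Points

variable (k : Type u) [Field k]

/-- The spectrum of a `k`-algebra as a scheme over `k`. -/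
abbrev specOver (R : Type u) [CommRing R] [Algebra k R] : Over (Spec (.of k)) :=
  (Spec (.of R)).asOver (Spec (.of k))

variable {k} {R R' R'' : Type u} [CommRing R] [Algebra k R] [CommRing R'] [Algebra k R']
  [CommRing R''] [Algebra k R'']

/-- The morphism of spectra induced by a homomorphism of `k`-algebras. -/
def specOverMap (f : R →ₐ[k] R') : specOver k R' ⟶ specOver k R :=
  (Spec.map (CommRingCat.ofHom f.toRingHom)).asOver _

lemma specOverMap_comp (f : R →ₐ[k] R') (g : R' →ₐ[k] R'') :
    specOverMap (g.comp f) = specOverMap g ≫ specOverMap f := by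
  ext1
  exact Spec.map_comp (CommRingCat.ofHom f.toRingHom) (CommRingCat.ofHom g.toRingHom)

/-- The homomorphism `k[T, T⁻¹] → R` sending `T` to the unit `a`. -/
def laurentHom (a : Rˣ) : k[T;T⁻¹] →ₐ[k] R :=
  { LaurentPolynomial.eval₂ (algebraMap k R) a with
    commutes' := fun r ↦ by
      have := LaurentPolynomial.eval₂_C (algebraMap k R) a r
      rwa [LaurentPolynomial.C_eq_algebraMap] at this }

lemma laurentHom_T (a : Rˣ) (n : ℤ) :
    laurentHom (k := k) a (LaurentPolynomial.T n) = ((a ^ n : Rˣ) : R) :=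
  LaurentPolynomial.eval₂_T _ _ _

lemma laurentHom_toLaurent (a : Rˣ) (p : k[X]) :
    laurentHom (k := k) a p.toLaurent = Polynomial.aeval (a : R) p :=
  LaurentPolynomial.eval₂_toLaurent _ _ _

lemma laurent_algHom_ext {f g : k[T;T⁻¹] →ₐ[k] R}
    (h : f (LaurentPolynomial.T 1) = g (LaurentPolynomial.T 1)) : f = g := by
  refine AlgHom.ext fun p ↦ ?_
  obtain ⟨n, p', hp⟩ := LaurentPolynomial.exists_T_pow p
  have h1 : IsUnit (LaurentPolynomial.T n : k[T;T⁻¹]) := LaurentPolynomial.isUnit_T n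
  have h2 : f.comp Polynomial.toLaurentAlg = g.comp Polynomial.toLaurentAlg := by
    ext
    simpa using h
  have h3 : f p'.toLaurent = g p'.toLaurent := congr($h2 p')
  have h4 : (LaurentPolynomial.T n : k[T;T⁻¹]) = (Polynomial.X ^ n : k[X]).toLaurent := by simp
  have h5 : f (LaurentPolynomial.T n) = g (LaurentPolynomial.T n) := by
    rw [h4]; exact congr($h2 _)
  rw [hp, map_mul, map_mul, ← h5] at h3
  exact (h1.map f).mul_right_cancel h3

lemma comp_laurentHom (a : Rˣ) (f : R →ₐ[k] R') :
    f.comp (laurentHom a) = laurentHom (Units.map f.toRingHom.toMonoidHom a) := by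
  apply laurent_algHom_ext
  simp [laurentHom_T]

/-- The point of `𝔾ₘ` given by a unit. -/
def gmPoint (a : Rˣ) : specOver k R ⟶ Gm k := specOverMap (laurentHom a)

lemma specOverMap_gmPoint (a : Rˣ) (f : R →ₐ[k] R') {b : R'ˣ} (hb : f a = b) :
    specOverMap f ≫ gmPoint a = gmPoint b := by
  rw [gmPoint, ← specOverMap_comp, comp_laurentHom]
  congr 2
  ext
  exact hb

/-- The product of points is convolution of algebra homomorphisms, and `T` is grouplike. -/
lemma gmPoint_mul (a b : Rˣ) : gmPoint (k := k) (a * b) = gmPoint a * gmPoint b := by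
  have h := (Spec.mapMulEquiv (R := k) (S := k[T;T⁻¹]) (T := R)).map_mul
    (WithConv.toConv (laurentHom a)) (WithConv.toConv (laurentHom b))
  refine Eq.trans ?_ h
  have : WithConv.toConv (laurentHom (k := k) (a * b)) =
      WithConv.toConv (laurentHom (k := k) a) * WithConv.toConv (laurentHom (k := k) b) := by
    apply WithConv.ofConv_injective
    apply laurent_algHom_ext
    simp [AlgHom.convMul_def, laurentHom_T]
  rw [← this]
  rfl

lemma gmPoint_one : gmPoint (k := k) (1 : Rˣ) = 1 := by
  have := gmPoint_mul (k := k) (1 : Rˣ) 1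
  rwa [one_mul, left_eq_mul] at this

lemma gmPoint_inv (a : Rˣ) : gmPoint (k := k) a⁻¹ = gmPoint a ≫ ι[Gm k] := by
  rw [← Hom.inv_def, eq_inv_iff_mul_eq_one, ← gmPoint_mul, inv_mul_cancel, gmPoint_one]

/-- The point of the affine line given by an element. -/
def affinePoint (b : R) : specOver k R ⟶ affineLine k := specOverMap (Polynomial.aeval b)

lemma specOverMap_affinePoint (b : R) (f : R →ₐ[k] R') :
    specOverMap f ≫ affinePoint b = affinePoint (f b) := by
  rw [affinePoint, ← specOverMap_comp, affinePoint]
  congr 1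
  ext
  simp

lemma gmPoint_GmToAffineLine (a : Rˣ) :
    gmPoint a ≫ GmToAffineLine k = affinePoint (a : R) := by
  have : GmToAffineLine k = specOverMap (Polynomial.toLaurentAlg (R := k)) := rfl
  rw [this, gmPoint, ← specOverMap_comp, affinePoint]
  congr 1
  ext
  simp [laurentHom_T]

lemma affinePoint_zero : affinePoint (0 : R) = toUnit (specOver k R) ≫ affineLineZero k := by
  ext1
  have h : (toUnit (specOver k R)).left = Spec.map (CommRingCat.ofHom (algebraMap k R)) :=
    (Category.comp_id _).symm.trans (Over.w (toUnit (specOver k R)))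
  have h' : CommRingCat.ofHom (Polynomial.aeval (R := k) (0 : R)).toRingHom =
      CommRingCat.ofHom (Polynomial.evalRingHom (0 : k)) ≫
        CommRingCat.ofHom (algebraMap k R) := by
    rw [← CommRingCat.ofHom_comp]
    congr 1
    ext <;> simp
  refine (congrArg Spec.map h').trans ((Spec.map_comp _ _).trans ?_)
  exact congr($(h.symm) ≫ _)

end Points

/-! ### Rational functions and power series -/

section RationalPowerSeries

variable (k : Type u) [Field k]

/-- The field of rational functions in the variable `t`. -/
abbrev RatField := FractionRing k[X]

/-- Power series in the variable `x` over the field of rational functions in `t`. -/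
abbrev RatSeries := PowerSeries (RatField k)

/-- The fraction field of the ring of power series. -/
abbrev RatLaurent := FractionRing (RatSeries k)

/-- The variable `t`. -/
def ratT : (RatField k)ˣ :=
  Units.mk0 (algebraMap k[X] (RatField k) Polynomial.X) (by simp)

lemma ratT_val : (ratT k : RatField k) = algebraMap k[X] (RatField k) Polynomial.X := rfl

/-- The variable `x`. -/
def ratX : (RatLaurent k)ˣ :=
  Units.mk0 (algebraMap (RatSeries k) (RatLaurent k) PowerSeries.X) (by
    simp)

lemma ratX_val : (ratX k : RatLaurent k) = algebraMap (RatSeries k) (RatLaurent k) PowerSeries.X :=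
  rfl

variable {k}

/-- A nonzero constant, as a unit of the field of fractions of the ring of power series. -/
def ratConst : (RatField k)ˣ →* (RatLaurent k)ˣ :=
  Units.map ((algebraMap (RatSeries k) (RatLaurent k)).comp (PowerSeries.C)).toMonoidHom

lemma ratConst_val (c : (RatField k)ˣ) : (ratConst c : RatLaurent k) =
    algebraMap (RatSeries k) (RatLaurent k) (PowerSeries.C (c : RatField k)) := rfl

lemma exists_eq_X_pow_mul {p : k[X]} (hp : p ≠ 0) :
    ∃ (i : ℕ) (p' : k[X]), p = Polynomial.X ^ i * p' ∧ p'.coeff 0 ≠ 0 := by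
  obtain ⟨p', h1, h2⟩ := p.exists_eq_pow_rootMultiplicity_mul_and_not_dvd hp 0
  refine ⟨_, p', by simpa using h1, ?_⟩
  rwa [map_zero, sub_zero, Polynomial.X_dvd_iff] at h2

lemma constantCoeff_aeval (b : RatSeries k) (hb : PowerSeries.constantCoeff b = 0) (p : k[X]) :
    PowerSeries.constantCoeff (Polynomial.aeval b p) = algebraMap k (RatField k) (p.coeff 0) := by
  induction p using Polynomial.induction_on' with
  | add p q hp hq => simp [hp, hq]
  | monomial n a =>
    rcases n with _ | n
    · simp [PowerSeries.algebraMap_apply]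
    · simp [hb, Polynomial.coeff_monomial]

lemma isUnit_aeval (b : RatSeries k) (hb : PowerSeries.constantCoeff b = 0) {p : k[X]}
    (hp : p.coeff 0 ≠ 0) : IsUnit (Polynomial.aeval b p) := by
  rw [PowerSeries.isUnit_iff_constantCoeff, constantCoeff_aeval b hb]
  exact (IsUnit.mk0 _ hp).map (algebraMap k (RatField k))

/-- The polynomial `p` evaluated at `c x` is `(c x) ^ i` times a unit. -/
lemma exists_aeval_eq {p : k[X]} (hp : p ≠ 0) : ∃ (i : ℕ) (e : k), e ≠ 0 ∧
    ∀ c : (RatField k)ˣ, ∃ v : (RatSeries k)ˣ,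
      PowerSeries.constantCoeff (v : RatSeries k) = algebraMap k (RatField k) e ∧
      Polynomial.aeval ((ratConst c * ratX k : (RatLaurent k)ˣ) : RatLaurent k) p =
        ((ratConst c * ratX k) ^ i : (RatLaurent k)ˣ) *
          algebraMap (RatSeries k) (RatLaurent k) v := by
  obtain ⟨i, p', rfl, hp'⟩ := exists_eq_X_pow_mul hp
  refine ⟨i, p'.coeff 0, hp', fun c ↦ ?_⟩
  have hb : PowerSeries.constantCoeff
    (PowerSeries.C (c : RatField k) * PowerSeries.X : RatSeries k) = 0 := by simp
  refine ⟨(isUnit_aeval _ hb hp').unit, constantCoeff_aeval _ hb p', ?_⟩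
  have h : ((ratConst c * ratX k : (RatLaurent k)ˣ) : RatLaurent k) =
    algebraMap (RatSeries k) (RatLaurent k) (PowerSeries.C (c : RatField k) * PowerSeries.X) := by
    simp [ratConst_val, ratX_val]
  rw [map_mul, map_pow, Polynomial.aeval_X, Units.val_pow_eq_pow_val]
  congr 1
  rw [h, Polynomial.aeval_algebraMap_apply]
  rfl

lemma aeval_injective (c : (RatField k)ˣ) : Function.Injective
    (Polynomial.aeval (R := k) ((ratConst c * ratX k : (RatLaurent k)ˣ) : RatLaurent k)) := by
  rw [injective_iff_map_eq_zero]
  intro p hp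
  by_contra h
  obtain ⟨i, e, -, h⟩ := exists_aeval_eq h
  obtain ⟨v, -, hv⟩ := h c
  rw [hp, eq_comm] at hv
  have h2 : IsUnit (algebraMap (RatSeries k) (RatLaurent k) v) := v.isUnit.map _
  exact ((((ratConst c * ratX k) ^ i).isUnit.mul h2).ne_zero) hv

/-- The substitution `t ↦ c x`. -/
def ratSubst (c : (RatField k)ˣ) : RatField k →ₐ[k] RatLaurent k :=
  IsFractionRing.liftAlgHom (aeval_injective c)

lemma ratSubst_algebraMap (c : (RatField k)ˣ) (p : k[X]) :
    ratSubst c (algebraMap _ _ p) =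
      Polynomial.aeval ((ratConst c * ratX k : (RatLaurent k)ˣ) : RatLaurent k) p :=
  IsFractionRing.lift_algebraMap (aeval_injective c) p

lemma ratSubst_ratT (c : (RatField k)ˣ) : ratSubst c (ratT k : RatField k) =
    ((ratConst c * ratX k : (RatLaurent k)ˣ) : RatLaurent k) := by
  rw [ratT_val, ratSubst_algebraMap, Polynomial.aeval_X]

/-- The order `m` and the leading coefficient `e` are chosen before `c`: neither depends on the
substitution `t ↦ c x`. This uniformity permits comparing `q(t x)` with `q(x)`. -/
lemma exists_ratSubst_eq {q : RatField k} (hq : q ≠ 0) : ∃ (m : ℤ) (e : k), e ≠ 0 ∧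
    ∀ c : (RatField k)ˣ, ∃ v : (RatSeries k)ˣ,
      PowerSeries.constantCoeff (v : RatSeries k) = algebraMap k (RatField k) e ∧
      ratSubst c q = ((ratConst c * ratX k) ^ m : (RatLaurent k)ˣ) *
          algebraMap (RatSeries k) (RatLaurent k) v := by
  obtain ⟨a, b, hb, rfl⟩ := IsFractionRing.div_surjective (A := k[X]) q
  have hb0 : b ≠ 0 := nonZeroDivisors.ne_zero hb
  have ha0 : a ≠ 0 := by rintro rfl; simp at hq
  obtain ⟨i, e, he, hi⟩ := exists_aeval_eq ha0
  obtain ⟨j, e', he', hj⟩ := exists_aeval_eq hb0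
  refine ⟨i - j, e * e'⁻¹, mul_ne_zero he (inv_ne_zero he'), fun c ↦ ?_⟩
  obtain ⟨v, hv, hv'⟩ := hi c
  obtain ⟨w, hw, hw'⟩ := hj c
  refine ⟨v * w⁻¹, ?_, ?_⟩
  · have h1 : PowerSeries.constantCoeff (w : RatSeries k) *
        PowerSeries.constantCoeff ((w⁻¹ : (RatSeries k)ˣ) : RatSeries k) = 1 := by
      rw [← map_mul, Units.mul_inv, map_one]
    rw [Units.val_mul, map_mul, hv, map_mul, map_inv₀, ← hw, eq_inv_of_mul_eq_one_right h1]
  · have h2 : algebraMap (RatSeries k) (RatLaurent k) ((w⁻¹ : (RatSeries k)ˣ) : RatSeries k) =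
        (algebraMap (RatSeries k) (RatLaurent k) w)⁻¹ := by
      apply eq_inv_of_mul_eq_one_right
      rw [← map_mul, Units.mul_inv, map_one]
    rw [map_div₀, ratSubst_algebraMap, ratSubst_algebraMap, hv', hw', Units.val_mul, map_mul, h2,
      zpow_sub, zpow_natCast, zpow_natCast, Units.val_mul, Units.val_inv_eq_inv_val, div_eq_mul_inv,
      mul_inv]
    ring

/-- If `q(t x) = β(x) q(x)` then `β(0) = t ^ m`, where `m` is the order of vanishing of `q`. -/
lemma exists_order {q : RatField k} (hq : q ≠ 0) {β : RatSeries k}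
    (h : ratSubst (ratT k) q = algebraMap (RatSeries k) (RatLaurent k) β * ratSubst 1 q) :
    ∃ m : ℤ, PowerSeries.constantCoeff β = ((ratT k ^ m : (RatField k)ˣ) : RatField k) ∧
      ∃ v : (RatSeries k)ˣ, ratSubst 1 q =
        (ratX k ^ m : (RatLaurent k)ˣ) * algebraMap (RatSeries k) (RatLaurent k) v := by
  obtain ⟨m, e, he, hm⟩ := exists_ratSubst_eq hq
  obtain ⟨v, hv, hv'⟩ := hm 1
  obtain ⟨w, hw, hw'⟩ := hm (ratT k)
  rw [map_one, one_mul] at hv'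
  refine ⟨m, ?_, v, hv'⟩
  rw [hv', hw', mul_zpow, ← map_zpow, Units.val_mul] at h
  -- Cancelling `x ^ m` and setting `x = 0` leaves `t ^ m * e = β(0) * e`.
  have h1 : ((ratX k ^ m : (RatLaurent k)ˣ) : RatLaurent k) * ((ratConst (ratT k ^ m) :
      (RatLaurent k)ˣ) * algebraMap (RatSeries k) (RatLaurent k) w) = (ratX k ^ m : (RatLaurent k)ˣ)
      * (algebraMap (RatSeries k) (RatLaurent k) β * algebraMap (RatSeries k) (RatLaurent k) v) := by
    linear_combination h
  have h2 := mul_left_cancel₀ (Units.ne_zero _) h1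
  rw [ratConst_val, ← map_mul, ← map_mul] at h2
  have h3 := congr(PowerSeries.constantCoeff $(IsFractionRing.injective _ _ h2))
  rw [map_mul, map_mul, hv, hw, PowerSeries.constantCoeff_C] at h3
  exact (mul_right_cancel₀ ((map_ne_zero _).mpr he) h3).symm

/-- If the exponents differed, cancelling the smaller power would exhibit a unit power series with
zero constant term. -/
lemma zpow_ratX_inj {a b : ℤ} {v w : (RatSeries k)ˣ}
    (h : ((ratX k ^ a : (RatLaurent k)ˣ) : RatLaurent k) *
        algebraMap (RatSeries k) (RatLaurent k) v =
      ((ratX k ^ b : (RatLaurent k)ˣ) : RatLaurent k) *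
        algebraMap (RatSeries k) (RatLaurent k) w) : a = b := by
  wlog hab : a ≤ b generalizing a b v w
  · exact (this h.symm (le_of_not_ge hab)).symm
  obtain ⟨n, rfl⟩ := Int.le.dest hab
  rw [zpow_add, Units.val_mul, mul_assoc] at h
  have h2 := mul_left_cancel₀ (Units.ne_zero _) h
  rw [zpow_natCast, Units.val_pow_eq_pow_val, ratX_val, ← map_pow, ← map_mul] at h2
  have h3 := IsFractionRing.injective _ _ h2
  rcases n with _ | n
  · simp
  · exfalso
    have h4 := PowerSeries.isUnit_constantCoeff _ v.isUnit
    rw [h3] at h4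
    simp at h4

lemma zpow_ratT_inj {a b : ℤ} (h : ratT k ^ a = ratT k ^ b) : a = b := by
  apply zpow_ratX_inj (k := k) (v := 1) (w := 1)
  have h1 := congr(ratSubst 1 (($h : (RatField k)ˣ) : RatField k))
  rw [Units.val_zpow_eq_zpow_val, Units.val_zpow_eq_zpow_val, map_zpow₀, map_zpow₀, ratSubst_ratT,
    map_one, one_mul] at h1
  simpa using h1

/-- A Laurent polynomial whose orders at `0` and `∞` are opposite is a monomial. -/
lemma isUnit_laurent {p : k[T;T⁻¹]} {N : ℤ} {v w : (RatSeries k)ˣ}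
    (h₁ : laurentHom (ratX k) p = ((ratX k ^ N : (RatLaurent k)ˣ) : RatLaurent k) *
      algebraMap (RatSeries k) (RatLaurent k) v)
    (h₂ : laurentHom (ratX k)⁻¹ p = ((ratX k ^ (-N) : (RatLaurent k)ˣ) : RatLaurent k) *
      algebraMap (RatSeries k) (RatLaurent k) w) : IsUnit p := by
  have key {f : k[X]} (hf : f.coeff 0 ≠ 0) : ∃ v : (RatSeries k)ˣ,
      Polynomial.aeval ((ratX k : (RatLaurent k)ˣ) : RatLaurent k) f =
        algebraMap (RatSeries k) (RatLaurent k) v := by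
    have hb : PowerSeries.constantCoeff (PowerSeries.X : RatSeries k) = 0 := by simp
    refine ⟨(isUnit_aeval _ hb hf).unit, ?_⟩
    rw [ratX_val, Polynomial.aeval_algebraMap_apply]
    rfl
  have hp0 : p ≠ 0 := by
    rintro rfl
    rw [map_zero, eq_comm] at h₁
    exact ((Units.isUnit _).mul (v.isUnit.map (algebraMap _ _))).ne_zero h₁
  obtain ⟨n, f₀, hf₀⟩ := LaurentPolynomial.exists_T_pow p
  have hf0 : f₀ ≠ 0 := by
    rintro rfl
    rw [map_zero, eq_comm] at hf₀
    exact hp0 ((LaurentPolynomial.isUnit_T _).mul_left_eq_zero.mp hf₀)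
  obtain ⟨i, f, rfl, hf⟩ := exists_eq_X_pow_mul hf0
  have hp : p = LaurentPolynomial.T (i - n) * f.toLaurent := by
    apply (LaurentPolynomial.isUnit_T (R := k) n).mul_right_cancel
    rw [← hf₀, map_mul, Polynomial.toLaurent_X_pow, mul_right_comm, ← LaurentPolynomial.T_add]
    congr 2
    ring
  subst hp
  rw [map_mul, laurentHom_T, laurentHom_toLaurent] at h₁ h₂
  obtain ⟨v₁, hv₁⟩ := key hf
  rw [hv₁] at h₁
  -- The order at `0` is `i - n = N`, so the condition at `∞` reduces to `f(x⁻¹)` being the unit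
  -- power series `w`.
  have hN := zpow_ratX_inj h₁
  rw [hN, inv_zpow, ← zpow_neg] at h₂
  have h3 := mul_left_cancel₀ (Units.ne_zero _) h₂
  have hr : f.reverse.coeff 0 ≠ 0 := by
    rw [Polynomial.coeff_zero_reverse]
    exact Polynomial.leadingCoeff_ne_zero.mpr (by rintro rfl; simp at hf)
  obtain ⟨v₂, hv₂⟩ := key hr
  -- The reversed polynomial is `x ^ deg f * f(x⁻¹)`, of order `deg f`. Its constant term is the
  -- leading coefficient of `f`, so its order is also `0`.
  have h4 : Polynomial.aeval ((ratX k : (RatLaurent k)ˣ) : RatLaurent k) f.reverse =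
      ((ratX k ^ (f.natDegree : ℤ) : (RatLaurent k)ˣ) : RatLaurent k) *
        algebraMap (RatSeries k) (RatLaurent k) w := by
    have := (ratX k)⁻¹.invertible
    have h5 := Polynomial.eval₂_reverse_mul_pow (algebraMap k (RatLaurent k))
      (((ratX k)⁻¹ : (RatLaurent k)ˣ) : RatLaurent k) f
    rw [← Polynomial.aeval_def, ← Polynomial.aeval_def, h3, invOf_units, inv_inv] at h5
    rw [← h5, mul_comm, mul_assoc, zpow_natCast, Units.val_pow_eq_pow_val, ← mul_pow,
      Units.inv_mul, one_pow, mul_one]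
  rw [hv₂] at h4
  have h5 : (0 : ℤ) = f.natDegree := by
    apply zpow_ratX_inj (v := v₂) (w := w)
    rw [zpow_zero, Units.val_one, one_mul]
    exact h4
  have h6 : f = Polynomial.C (f.coeff 0) := Polynomial.eq_C_of_natDegree_eq_zero (by omega)
  refine (LaurentPolynomial.isUnit_T _).mul ?_
  rw [h6]
  exact ((IsUnit.mk0 _ hf).map Polynomial.C).map _

end RationalPowerSeries

/-! ### Global functions on spectra of `k`-algebras -/

section Values

variable {k : Type u} [Field k] {R R' : Type u} [CommRing R] [Algebra k R] [CommRing R']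
  [Algebra k R']

variable (k R) in
/-- Global functions on `Spec R` as elements of `R`. -/
def specVal : Γ((specOver k R).left, ⊤) →+* R := (Scheme.ΓSpecIso (.of R)).hom.hom

lemma specVal_bijective : Function.Bijective (specVal k R) :=
  ConcreteCategory.bijective_of_isIso (Scheme.ΓSpecIso (.of R)).hom

lemma specVal_appTop (f : R →ₐ[k] R') (r : Γ((specOver k R).left, ⊤)) :
    specVal k R' ((specOverMap f).left.appTop r) = f (specVal k R r) :=
  congr($(Scheme.ΓSpecIso_naturality (CommRingCat.ofHom f.toRingHom)) r)

end Values

/-! ### Landing of points -/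

section Landing

variable {k : Type u} [Field k] {R R' : Type u} [CommRing R] [Algebra k R] [CommRing R']
  [Algebra k R'] {Y : Over (Spec (.of k))}

/-- A local homomorphism matches the closed points, and every point of `Spec R` specializes to the
closed one, so an open set containing the closed point is everything. -/
lemma lands_of_isLocalHom [IsLocalRing R] [IsLocalRing R'] (f : R →ₐ[k] R')
    [hf : IsLocalHom f.toRingHom] (x : specOver k R ⟶ Y) {x' : specOver k R' ⟶ Y}
    (hx : specOverMap f ≫ x = x')
    {V : Y.left.Opens} (h : ⊤ ≤ x'.left ⁻¹ᵁ V) : ⊤ ≤ x.left ⁻¹ᵁ V := by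
  subst hx
  have h1 : IsLocalRing.closedPoint R ∈ x.left ⁻¹ᵁ V := by
    have h2 := h (show IsLocalRing.closedPoint R' ∈ _ from trivial)
    have h3 := IsLocalRing.comap_closedPoint f.toRingHom
    rw [← h3]
    exact h2
  intro p _
  exact (IsLocalRing.specializes_closedPoint p).mem_open (x.left ⁻¹ᵁ V).2 h1

lemma lands_of_toUnit_comp_eq (z : 𝟙_ (Over (Spec (.of k))) ⟶ Y)
    {V : Y.left.Opens} (h : ⊤ ≤ z.left ⁻¹ᵁ V) (x : specOver k R ⟶ Y)
    (hx : toUnit _ ≫ z = x) : ⊤ ≤ x.left ⁻¹ᵁ V :=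
  comp_mem_of_mem (toUnit (specOver k R)).left z.left (by rw [← hx]; rfl) h

end Landing

/-! ### Points of orbits and of their limits -/

section Orbits

variable {k : Type u} [Field k] {R R' : Type u} [CommRing R] [Algebra k R] [CommRing R']
  [Algebra k R'] {Y : Over (Spec (.of k))}

/-- `Spec K ⟶ Spec R` is dominant, `Spec R` is reduced and `Y` is separated. -/
lemma hom_ext_of_isFractionRing [IsSeparated Y.hom] [IsDomain R] {K : Type u} [Field K]
    [Algebra k K] [Algebra R K] [IsScalarTower k R K] [IsFractionRing R K]
    {f g : specOver k R ⟶ Y}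
    (h : specOverMap (IsScalarTower.toAlgHom k R K) ≫ f =
      specOverMap (IsScalarTower.toAlgHom k R K) ≫ g) : f = g := by
  ext1
  have : IsDominant (specOverMap (IsScalarTower.toAlgHom k R K)).left := by
    refine ⟨(PrimeSpectrum.denseRange_comap_iff_ker_le_nilRadical _).mpr ?_⟩
    have : RingHom.ker (algebraMap R K) = ⊥ :=
      (RingHom.injective_iff_ker_eq_bot _).mp (IsFractionRing.injective R K)
    exact this.trans_le bot_le
  have : IsReduced (specOver k R).left := inferInstanceAs (IsReduced (Spec (.of R)))
  refine ext_of_isDominant_of_isSeparated Y.hom (by rw [Over.w, Over.w])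
    (specOverMap (IsScalarTower.toAlgHom k R K)).left ?_
  rw [← Over.comp_left, ← Over.comp_left, h]

lemma specOverMap_gmPoint_zpow (a : Rˣ) (f : R →ₐ[k] R') {b : R'ˣ} (hb : f a = b) (e : ℤ) :
    specOverMap f ≫ gmPoint (a ^ e) = gmPoint (b ^ e) := by
  apply specOverMap_gmPoint
  obtain rfl : b = Units.map f.toRingHom.toMonoidHom a := Units.ext hb.symm
  rw [← map_zpow]
  rfl

lemma comp_orbitMap {G : Over (Spec (.of k))} [GrpObj G] [ModObj G Y] {T : Over (Spec (.of k))}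
    (g : T ⟶ G) (y : 𝟙_ (Over (Spec (.of k))) ⟶ Y) :
    g ≫ orbitMap G y = g • (toUnit T ≫ y) := by
  rw [orbitMap, comp_lift_assoc, Category.comp_id, Hom.smul_def, ← Category.assoc]
  congr 3
  exact toUnit_unique _ _

lemma specOverMap_comp_affinePoint_comp (φ : affineLine k ⟶ Y) (f : R →ₐ[k] R') {a : R} {b : R'} (h : f a = b) :
    specOverMap f ≫ affinePoint a ≫ φ = affinePoint b ≫ φ := by
  rw [← Category.assoc, specOverMap_affinePoint, h]

lemma specOverMap_comp_toUnit_comp (f : R →ₐ[k] R') (x : 𝟙_ (Over (Spec (.of k))) ⟶ Y) :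
    specOverMap f ≫ toUnit (specOver k R) ≫ x = toUnit (specOver k R') ≫ x := by
  rw [← Category.assoc]
  congr 1
  exact toUnit_unique _ _

variable [ModObj (Gm k) Y]

/-- The morphism `φ` extends the map `a ↦ a ^ e • y`, with value `z` at the origin. -/
structure ExtendsOrbit (y z : 𝟙_ (Over (Spec (.of k))) ⟶ Y) (e : ℤ) (φ : affineLine k ⟶ Y) :
    Prop where
  affinePoint_unit (R : Type u) [CommRing R] [Algebra k R] (a : Rˣ) :
    affinePoint (a : R) ≫ φ = gmPoint (k := k) (a ^ e) • (toUnit (specOver k R) ≫ y)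
  affineLineZero_comp : affineLineZero k ≫ φ = z

lemma TendsToAtZero.exists_extendsOrbit {y z : 𝟙_ (Over (Spec (.of k))) ⟶ Y}
    (h : TendsToAtZero (orbitMap (Gm k) y) z) : ∃ φ, GmToAffineLine k ≫ φ = orbitMap (Gm k) y ∧
      ExtendsOrbit y z 1 φ := by
  obtain ⟨φ, h1, h2⟩ := h
  refine ⟨φ, h1, fun R _ _ a ↦ ?_, h2⟩
  rw [← gmPoint_GmToAffineLine, Category.assoc, h1, comp_orbitMap, zpow_one]

lemma TendsToAtInfinity.exists_extendsOrbit {y z : 𝟙_ (Over (Spec (.of k))) ⟶ Y}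
    (h : TendsToAtInfinity (orbitMap (Gm k) y) z) :
    ∃ φ, GmToAffineLine k ≫ φ = ι[Gm k] ≫ orbitMap (Gm k) y ∧ ExtendsOrbit y z (-1) φ := by
  obtain ⟨φ, h1, h2⟩ := h
  refine ⟨φ, h1, fun R _ _ a ↦ ?_, h2⟩
  rw [← gmPoint_GmToAffineLine, Category.assoc, h1, ← Category.assoc, ← gmPoint_inv,
    comp_orbitMap, zpow_neg_one]

namespace ExtendsOrbit

variable {y z : 𝟙_ (Over (Spec (.of k))) ⟶ Y} {e : ℤ} {φ : affineLine k ⟶ Y}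

lemma affinePoint_zero (h : ExtendsOrbit y z e φ) (R : Type u) [CommRing R] [Algebra k R] :
    affinePoint (0 : R) ≫ φ = toUnit (specOver k R) ≫ z := by
  rw [_root_.affinePoint_zero, Category.assoc, h.affineLineZero_comp]

lemma smul_affinePoint_unit (h : ExtendsOrbit y z e φ) (c a : Rˣ) :
    gmPoint (k := k) (c ^ e) • (affinePoint (a : R) ≫ φ) =
      affinePoint ((c * a : Rˣ) : R) ≫ φ := by
  rw [h.affinePoint_unit, h.affinePoint_unit, mul_zpow, gmPoint_mul, mul_smul]

/-- Over the fraction field `a` becomes invertible and the identity is the action law; separatedness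
brings it back to `R`. The case of interest is the non-unit `a = x` in `k(t)[[x]]`. -/
lemma smul_affinePoint [IsSeparated Y.hom] [IsDomain R] (h : ExtendsOrbit y z e φ) (c : Rˣ) {a : R}
    (ha : a ≠ 0) : gmPoint (k := k) (c ^ e) • (affinePoint a ≫ φ) = affinePoint (c * a) ≫ φ := by
  apply hom_ext_of_isFractionRing (K := FractionRing R)
  set f := IsScalarTower.toAlgHom k R (FractionRing R)
  have ha' : algebraMap R (FractionRing R) a ≠ 0 := by simpa using ha
  rw [ModObj.comp_smul, specOverMap_gmPoint (c ^ e) f (b := Units.map f.toRingHom.toMonoidHom c ^ e)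
    (by rw [← map_zpow]; rfl), ← Category.assoc, ← Category.assoc, specOverMap_affinePoint,
    specOverMap_affinePoint]
  exact (h.smul_affinePoint_unit (Units.map f.toRingHom.toMonoidHom c) (Units.mk0 _ ha')).trans
    (by simp [f])

/-- The identity of `smul_affinePoint` specializes along `f`, where `a` becomes `0`. It shows that
the limit `z` is fixed. -/
lemma smul_toUnit [IsSeparated Y.hom] (h : ExtendsOrbit y z e φ) (c : Rˣ) {B : Type u} [CommRing B]
    [Algebra k B] [IsDomain B] (f : B →ₐ[k] R) {c' : Bˣ} (hc : f c' = c) {a : B} (ha : a ≠ 0)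
    (hfa : f a = 0) :
    gmPoint (k := k) (c ^ e) • (toUnit (specOver k R) ≫ z) = toUnit (specOver k R) ≫ z := by
  have h1 := congr(specOverMap f ≫ $(h.smul_affinePoint c' ha))
  have hc' : c = Units.map f.toRingHom.toMonoidHom c' := by ext; exact hc.symm
  rwa [ModObj.comp_smul, specOverMap_gmPoint (c' ^ e) f (b := c ^ e)
    (by rw [hc', ← map_zpow]; rfl), ← Category.assoc, ← Category.assoc, specOverMap_affinePoint,
    specOverMap_affinePoint, map_mul, hfa, mul_zero, h.affinePoint_zero] at h1

end ExtendsOrbit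

end Orbits

/-! ### The weight of the linearization at a limit point -/

section Limits

variable {k : Type u} [Field k] {R R' : Type u} [CommRing R] [Algebra k R] [CommRing R']
  [Algebra k R'] {Y : Over (Spec (.of k))} [ModObj (Gm k) Y] {L : Y.left.Modules}

namespace Linearization

variable (Φ : Linearization (Gm k) Y L)

/-- The linearization at affine points. -/
def specFactor (g : specOver k R ⟶ Gm k) (x : specOver k R ⟶ Y) {w : specOver k R ⟶ Y}
    (hw : g • x = w) {b b' : L.LocalFrame} (hb : b.Lands w.left) (hb' : b'.Lands x.left) : R :=
  specVal k R (Φ.factor g x hw hb hb')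

lemma isUnit_specFactor (g : specOver k R ⟶ Gm k) (x : specOver k R ⟶ Y) {w : specOver k R ⟶ Y}
    (hw : g • x = w) {b b' : L.LocalFrame} (hb : b.Lands w.left) (hb' : b'.Lands x.left) :
    IsUnit (Φ.specFactor g x hw hb hb') :=
  (Φ.isUnit_factor g x hw hb hb').map _

lemma specFactor_mul (g h : specOver k R ⟶ Gm k) (x : specOver k R ⟶ Y) {w v : specOver k R ⟶ Y}
    (hw : h • x = w) (hv : g • w = v) (hgh : (g * h) • x = v) {b b' b'' : L.LocalFrame}
    (hb : b.Lands v.left) (hb' : b'.Lands w.left) (hb'' : b''.Lands x.left) :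
    Φ.specFactor (g * h) x hgh hb hb'' =
      Φ.specFactor g w hv hb hb' * Φ.specFactor h x hw hb' hb'' := by
  rw [specFactor, Φ.factor_mul g h x hw hv hgh hb hb' hb'', map_mul]
  rfl

lemma map_specFactor (f : R →ₐ[k] R') (g : specOver k R ⟶ Gm k) (x : specOver k R ⟶ Y)
    {w : specOver k R ⟶ Y} (hw : g • x = w) {g' : specOver k R' ⟶ Gm k} {x' w' : specOver k R' ⟶ Y}
    (hg : specOverMap f ≫ g = g') (hx : specOverMap f ≫ x = x') (hfw : specOverMap f ≫ w = w')
    (hw' : g' • x' = w') {b b' : L.LocalFrame} (hb : b.Lands w.left) (hb' : b'.Lands x.left)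
    (hb₁ : b.Lands w'.left) (hb₁' : b'.Lands x'.left) :
    f (Φ.specFactor g x hw hb hb') = Φ.specFactor g' x' hw' hb₁ hb₁' := by
  rw [specFactor, ← specVal_appTop, Φ.appTop_factor (specOverMap f) g x hw hg hx hfw hw' hb hb'
    hb₁ hb₁']
  rfl

lemma specFactor_congr {g g' : specOver k R ⟶ Gm k} (hg : g = g') {x x' : specOver k R ⟶ Y}
    (hx : x = x') {w w' : specOver k R ⟶ Y} (hw : g • x = w) (hw' : g' • x' = w')
    {b b' : L.LocalFrame} (hb : b.Lands w.left) (hb' : b'.Lands x.left) (hb₁ : b.Lands w'.left)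
    (hb₁' : b'.Lands x'.left) :
    Φ.specFactor g x hw hb hb' = Φ.specFactor g' x' hw' hb₁ hb₁' := by
  subst hg hx hw hw'
  rfl

end Linearization

/-- Substitution of zero in power series, over the base field. -/
def constantCoeffAlgHom (k : Type u) [Field k] : RatSeries k →ₐ[k] RatField k :=
  { PowerSeries.constantCoeff (R := RatField k) with
    commutes' := fun r ↦ by
      simp [PowerSeries.algebraMap_apply] }

namespace ExtendsOrbit

variable {y z : 𝟙_ (Over (Spec (.of k))) ⟶ Y} {e : ℤ} {φ : affineLine k ⟶ Y}

/-- The closed point of `Spec k(t)[[x]]` goes to the image of `z`, and setting `x = 0` is a local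
homomorphism. -/
lemma lands_series (h : ExtendsOrbit y z e φ) {V : Y.left.Opens}
    (hz : ⊤ ≤ z.left ⁻¹ᵁ V) {a : RatSeries k}
    (ha : PowerSeries.constantCoeff a = 0) :
    ⊤ ≤ (affinePoint (k := k) a ≫ φ).left ⁻¹ᵁ V := by
  have : IsLocalHom (constantCoeffAlgHom k).toRingHom :=
    ⟨fun a ha ↦ PowerSeries.isUnit_iff_constantCoeff.mpr ha⟩
  exact lands_of_isLocalHom (constantCoeffAlgHom k) _
    ((specOverMap_comp_affinePoint_comp _ _ ha).trans (h.affinePoint_zero _))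
    (lands_of_toUnit_comp_eq z hz _ rfl)

lemma lands_laurent (h : ExtendsOrbit y z e φ) {V : Y.left.Opens}
    (hz : ⊤ ≤ z.left ⁻¹ᵁ V) (c : (RatField k)ˣ) :
    ⊤ ≤ (affinePoint (k := k) ((ratConst c * ratX k : (RatLaurent k)ˣ) : RatLaurent k) ≫ φ).left
      ⁻¹ᵁ V := by
  refine comp_mem_of_mem (specOverMap (IsScalarTower.toAlgHom k (RatSeries k) (RatLaurent k))).left
    _ ?_ (h.lands_series hz (a := PowerSeries.C (c : RatField k) * PowerSeries.X) (by simp))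
  rw [← Over.comp_left, specOverMap_comp_affinePoint_comp]
  simp [ratConst_val, ratX_val]

/-- The substitution `t ↦ x` is a homomorphism of fields, hence local, which reduces the claim to a
point already known to be close to the limit. -/
lemma lands_ratT (h : ExtendsOrbit y z e φ) {V : Y.left.Opens}
    (hz : ⊤ ≤ z.left ⁻¹ᵁ V) :
    ⊤ ≤ (affinePoint (k := k) (ratT k : RatField k) ≫ φ).left ⁻¹ᵁ V := by
  have : IsLocalHom (ratSubst (k := k) 1).toRingHom :=
    inferInstance
  exact lands_of_isLocalHom (ratSubst (k := k) 1) _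
    (specOverMap_comp_affinePoint_comp _ _ (ratSubst_ratT 1)) (h.lands_laurent hz 1)

/-- The order at the origin of the linearization along an orbit with limit `z` is the weight of the
linearization at `z`. -/
lemma exists_weight [IsSeparated Y.hom] (h : ExtendsOrbit y z e φ) (Φ : Linearization (Gm k) Y L)
    {b c : L.LocalFrame} (hb : b.Lands z.left) (hc : c.Lands y.left) :
    ∃ m : ℤ, (∃ hz h₁ h₂, Φ.specFactor (b := b) (b' := b) (gmPoint (ratT k ^ e))
        (toUnit (specOver k (RatField k)) ≫ z) (w := toUnit (specOver k (RatField k)) ≫ z)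
        hz h₁ h₂ = ((ratT k ^ m : (RatField k)ˣ) : RatField k)) ∧
      ∀ (w : _) (hw) (h₁) (h₂), ∃ v : (RatSeries k)ˣ,
        Φ.specFactor (b := b) (b' := c) (gmPoint (ratX k ^ e))
          (toUnit (specOver k (RatLaurent k)) ≫ y) (w := w) hw h₁ h₂ =
        ((ratX k ^ m : (RatLaurent k)ˣ) : RatLaurent k) *
          algebraMap (RatSeries k) (RatLaurent k) v := by
  set K := RatLaurent k
  have hy (R : Type u) [CommRing R] [Algebra k R] : c.Lands (toUnit (specOver k R) ≫ y).left :=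
    lands_of_toUnit_comp_eq y hc _ rfl
  have hzR (R : Type u) [CommRing R] [Algebra k R] : b.Lands (toUnit (specOver k R) ≫ z).left :=
    lands_of_toUnit_comp_eq z hb _ rfl
  -- The linearization from `y` to `φ(t)`, as a rational function of `t`; `hqK` computes `q(a x)`.
  set q : RatField k := Φ.specFactor (gmPoint (ratT k ^ e)) _ (h.affinePoint_unit _ (ratT k)).symm
    (h.lands_ratT hb) (hy _) with hq
  have hq0 : q ≠ 0 := (Φ.isUnit_specFactor _ _ _ _ _).ne_zero
  have hqK (a : (RatField k)ˣ) : ratSubst a q = Φ.specFactor (gmPoint ((ratConst a * ratX k) ^ e)) _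
      (h.affinePoint_unit _ (ratConst a * ratX k)).symm (h.lands_laurent hb a) (hy _) :=
    Φ.map_specFactor _ _ _ _ (specOverMap_gmPoint_zpow _ _ (ratSubst_ratT a) e)
      (specOverMap_comp_toUnit_comp _ _) (specOverMap_comp_affinePoint_comp _ _ (ratSubst_ratT a))
      _ _ _ _ _
  let t' : (RatSeries k)ˣ := Units.map (PowerSeries.C (R := RatField k)).toMonoidHom (ratT k)
  have hX : PowerSeries.constantCoeff (PowerSeries.X : RatSeries k) = 0 := by simp
  have htX : PowerSeries.constantCoeff ((t' : RatSeries k) * PowerSeries.X : RatSeries k) = 0 := by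
    simp
  have hcc : constantCoeffAlgHom k t' = ratT k := PowerSeries.constantCoeff_C _
  -- The linearization from `φ(x)` to `φ(t x)` in the single frame `b`. It is a power series in `x`
  -- because both points stay near `z`, and its value at `x = 0` is the action of `t ^ e` on the
  -- fibre at `z`.
  set β : RatSeries k := Φ.specFactor (gmPoint (t' ^ e)) _
    (h.smul_affinePoint t' PowerSeries.X_ne_zero) (h.lands_series hb htX) (h.lands_series hb hX)
    with hβ
  have hz := h.smul_toUnit (ratT k) (constantCoeffAlgHom k) hcc PowerSeries.X_ne_zero hX
  have hβ0 : PowerSeries.constantCoeff β = Φ.specFactor (gmPoint (ratT k ^ e)) _ hz (hzR _)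
      (hzR _) :=
    Φ.map_specFactor (constantCoeffAlgHom k) _ _ _ (specOverMap_gmPoint_zpow _ _ hcc e)
      ((specOverMap_comp_affinePoint_comp _ _ hX).trans (h.affinePoint_zero _))
      ((specOverMap_comp_affinePoint_comp _ _ htX).trans (h.affinePoint_zero _)) _ _ _ _ _
  have hl1 := h.lands_laurent hb 1
  rw [map_one, one_mul] at hl1
  have hβK : algebraMap (RatSeries k) K β = Φ.specFactor (gmPoint (ratConst (ratT k) ^ e)) _
      (h.smul_affinePoint_unit (ratConst (ratT k)) (ratX k)) (h.lands_laurent hb (ratT k)) hl1 :=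
    Φ.map_specFactor (IsScalarTower.toAlgHom k (RatSeries k) K) _ _ _
      (specOverMap_gmPoint_zpow _ _ rfl e) (specOverMap_comp_affinePoint_comp _ _ rfl)
      (specOverMap_comp_affinePoint_comp _ _ (map_mul (algebraMap _ _) _ _)) _ _ _ _ _
  have hq1 : ratSubst 1 q = Φ.specFactor (gmPoint (ratX k ^ e)) _
      (h.affinePoint_unit _ (ratX k)).symm hl1 (hy _) := by
    rw [hqK]
    exact Φ.specFactor_congr (by rw [map_one, one_mul]) rfl _ _ _ _ _ _
  -- The cocycle condition for `(t x) ^ e = t ^ e * x ^ e`.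
  have key : ratSubst (ratT k) q = algebraMap (RatSeries k) K β * ratSubst 1 q := by
    rw [hβK, hq1, hqK, ← Φ.specFactor_mul _ _ _ _ _ (by
      rw [← gmPoint_mul, ← mul_zpow]; exact (h.affinePoint_unit _ _).symm)]
    exact Φ.specFactor_congr (by rw [← gmPoint_mul, mul_zpow]) rfl _ _ _ _ _ _
  obtain ⟨m, h1, v, h2⟩ := exists_order hq0 key
  refine ⟨m, ⟨hz, hzR _, hzR _, hβ0.symm.trans h1⟩, ?_⟩
  intro w hw h₁ h₂
  refine ⟨v, ?_⟩
  rw [← h2, hq1]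
  exact Φ.specFactor_congr rfl rfl _ _ _ _ _ _

end ExtendsOrbit

end Limits

/-! ### Functions on open subschemes -/

namespace AlgebraicGeometry.Scheme

lemma ι_preimage_self_ge {X : Scheme.{u}} (D : X.Opens) : ⊤ ≤ D.ι ⁻¹ᵁ D :=
  fun x _ ↦ x.2

lemma evalAt_ι_bijective {X : Scheme.{u}} (D : X.Opens) :
    Function.Bijective (evalAt D.ι (ι_preimage_self_ge D)) := by
  have : Function.Bijective D.topIso.inv := ConcreteCategory.bijective_of_isIso D.topIso.inv
  convert this using 1
  funext r
  have h : D.topIso.inv = X.presheaf.map (homOfLE (D.ι_image_top.le)).op := rfl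
  rw [h]
  have h2 : D.ι.app D ≫ (D : Scheme).presheaf.map (homOfLE (ι_preimage_self_ge D)).op =
    X.presheaf.map (homOfLE (D.ι_image_top.le)).op :=
    (X.presheaf.map_comp _ _).symm
  exact congr($h2 r)

end AlgebraicGeometry.Scheme

/-! ### Coordinates of sections of tensor powers -/

namespace AlgebraicGeometry.Scheme.Modules

variable {X : Scheme.{u}} {L : X.Modules}

/-- The coordinate of a section of `L ^ n` with respect to a local frame of `L`. -/
def LocalFrame.coord (b : L.LocalFrame) {n : ℕ} (s : Γ(L.tensorPow n, ⊤)) : Γ(X, b.opens) :=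
  ((b.isFrame.powSection n).bijective.2 ((L.tensorPow n).res le_top s)).choose

lemma LocalFrame.coord_smul (b : L.LocalFrame) {n : ℕ} (s : Γ(L.tensorPow n, ⊤)) :
    b.coord s • powSection b.sec n = (L.tensorPow n).res le_top s :=
  ((b.isFrame.powSection n).bijective.2 ((L.tensorPow n).res le_top s)).choose_spec

lemma LocalFrame.mem_nonvanishingLocus_iff (b : L.LocalFrame) {n : ℕ} (s : Γ(L.tensorPow n, ⊤))
    {x : X} (hx : x ∈ b.opens) :
    x ∈ (L.tensorPow n).nonvanishingLocus s ↔ x ∈ X.basicOpen (b.coord s) :=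
  Modules.mem_nonvanishingLocus_iff (b.isFrame.powSection n) (b.coord_smul s).symm hx

/-- A single transition function `r` serves all powers, acting on coordinates in degree `n` through
`r ^ n`. -/
lemma LocalFrame.exists_res_eq_smul (b c : L.LocalFrame) : ∃ r : Γ(X, b.opens ⊓ c.opens),
    L.res inf_le_left b.sec = r • L.res inf_le_right c.sec ∧
    ∀ (n : ℕ) (s : Γ(L.tensorPow n, ⊤)),
      X.resFun inf_le_left (b.coord s) * r ^ n = X.resFun inf_le_right (c.coord s) := by
  obtain ⟨r, hr⟩ := (c.isFrame _ (inf_le_right : b.opens ⊓ c.opens ≤ c.opens)).2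
    (L.res inf_le_left b.sec)
  refine ⟨r, hr.symm, fun n s ↦ ?_⟩
  apply ((c.isFrame.powSection n) _ (inf_le_right : b.opens ⊓ c.opens ≤ c.opens)).1
  have h1 := congr((L.tensorPow n).res (inf_le_left : b.opens ⊓ c.opens ≤ b.opens)
    $(b.coord_smul s))
  have h2 := congr((L.tensorPow n).res (inf_le_right : b.opens ⊓ c.opens ≤ c.opens)
    $(c.coord_smul s))
  rw [res_smul', res_res, res_powSection] at h1 h2
  rw [← hr] at h1
  have h3 := powSection_smul r (L.res (inf_le_right : b.opens ⊓ c.opens ≤ c.opens) c.sec) n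
  have h4 := res_powSection (inf_le_right : b.opens ⊓ c.opens ≤ c.opens) c.sec n
  change (_ * _) • (L.tensorPow n).res _ _ = _ • (L.tensorPow n).res _ _
  rw [h4, h2, ← h1, mul_smul, ← h3]
  rfl

end AlgebraicGeometry.Scheme.Modules

/-! ### Sections of powers along an orbit, as functions -/

namespace Linearization

variable {S : Scheme.{u}} {G : Over S} [GrpObj G] {Y : Over S} [ModObj G Y]
  {L : Y.left.Modules} (Φ : Linearization G Y L) {T T' : Over S}

/-- The pullback of a section of `L ^ n` to a point `g • x = w`, as a function, where `L` is
trivialized by means of the linearization and a local frame at `x`. -/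
def sectionVal {n : ℕ} (s : Γ(L.tensorPow n, ⊤)) (g : T ⟶ G) (x : T ⟶ Y) {w : T ⟶ Y}
    (hw : g • x = w) {b c : L.LocalFrame} (hb : b.Lands w.left) (hc : c.Lands x.left) :
    Γ(T.left, ⊤) :=
  evalAt w.left hb (b.coord s) * Φ.factor g x hw hb hc ^ n

lemma appTop_sectionVal {n : ℕ} (s : Γ(L.tensorPow n, ⊤)) (f : T' ⟶ T) (g : T ⟶ G) (x : T ⟶ Y)
    {w : T ⟶ Y} (hw : g • x = w) {g' : T' ⟶ G} {x' w' : T' ⟶ Y} (hg : f ≫ g = g')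
    (hx : f ≫ x = x') (hfw : f ≫ w = w') (hw' : g' • x' = w') {b c : L.LocalFrame}
    (hb : b.Lands w.left) (hc : c.Lands x.left) (hb₁ : b.Lands w'.left) (hc₁ : c.Lands x'.left) :
    f.left.appTop (Φ.sectionVal s g x hw hb hc) = Φ.sectionVal s g' x' hw' hb₁ hc₁ := by
  rw [sectionVal, map_mul, map_pow, Φ.appTop_factor f g x hw hg hx hfw hw' hb hc hb₁ hc₁,
    appTop_evalAt f.left w.left (by rw [← hfw]; rfl) hb hb₁]
  rfl

/-- The transition function enters the coordinate and the `n`-th power of the factor with opposite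
exponents. -/
lemma sectionVal_change {n : ℕ} (s : Γ(L.tensorPow n, ⊤)) (g : T ⟶ G) (x : T ⟶ Y) {w : T ⟶ Y}
    (hw : g • x = w) {b b' c : L.LocalFrame} (hb : b.Lands w.left) (hb' : b'.Lands w.left)
    (hc : c.Lands x.left) :
    Φ.sectionVal s g x hw hb hc = Φ.sectionVal s g x hw hb' hc := by
  obtain ⟨r, hr, h⟩ := b.exists_res_eq_smul b'
  have hV : ⊤ ≤ w.left ⁻¹ᵁ (b.opens ⊓ b'.opens) := fun t ht ↦ ⟨hb ht, hb' ht⟩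
  rw [sectionVal, sectionVal, Φ.factor_change g x hw hb hb' hc inf_le_left inf_le_right hV r hr,
    mul_pow, ← mul_assoc, ← evalAt_resFun w.left inf_le_left hV hb,
    ← evalAt_resFun w.left inf_le_right hV hb', ← h, map_mul, map_pow]

/-- `sectionVal` needs one frame valid along all of `w`, which need not exist. Since the value is
independent of the frame, the local values glue to a function `p`, characterized by its values at
all points that do land in one frame. -/
lemma exists_eq_sectionVal (hL : L.IsLineBundle) {n : ℕ} (s : Γ(L.tensorPow n, ⊤))
    (x w : T ⟶ Y) (g : T ⟶ G) (hw : g • x = w) {c : L.LocalFrame} (hc : c.Lands x.left) :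
    ∃ p : Γ(T.left, ⊤), ∀ (T' : Over S) (f : T' ⟶ T) (b : L.LocalFrame) (g' : T' ⟶ G)
      (x' w' : T' ⟶ Y) (_ : f ≫ g = g') (_ : f ≫ x = x') (_ : f ≫ w = w') (hw' : g' • x' = w')
      (hb : b.Lands w'.left) (hc' : c.Lands x'.left),
      f.left.appTop p = Φ.sectionVal s g' x' hw' hb hc' := by
  let D (b : L.LocalFrame) : T.left.Opens := w.left ⁻¹ᵁ b.opens
  let P (W : T.left.Opens) : Over S := Over.mk (W.ι ≫ T.hom)
  let i (W : T.left.Opens) : P W ⟶ T := Over.homMk W.ι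
  have hP (W : T.left.Opens) : (i W ≫ g) • (i W ≫ x) = i W ≫ w := by
    rw [← ModObj.comp_smul, hw]
  have hPc (W : T.left.Opens) : c.Lands (i W ≫ x).left := hc.comp (i W).left rfl
  have hPb (W : T.left.Opens) (b : L.LocalFrame) (h : W ≤ D b) : b.Lands (i W ≫ w).left :=
    fun t _ ↦ h t.2
  -- The inclusion of `D b` lands in the frame `b`, so its section value is a function on `D b`.
  choose r hr using fun b ↦ (evalAt_ι_bijective (D b)).2
    (Φ.sectionVal s (i (D b) ≫ g) (i (D b) ≫ x) (hP _) (hPb _ b le_rfl) (hPc _))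
  have key (T' : Over S) (f : T' ⟶ T) (b : L.LocalFrame) (g' : T' ⟶ G)
      (x' w' : T' ⟶ Y) (hg : f ≫ g = g') (hx : f ≫ x = x') (hfw : f ≫ w = w') (hw' : g' • x' = w')
      (hb : b.Lands w'.left) (hc' : c.Lands x'.left) (hD : ⊤ ≤ f.left ⁻¹ᵁ D b) :
      evalAt f.left hD (r b) = Φ.sectionVal s g' x' hw' hb hc' := by
    have hrange : Set.range f.left ⊆ Set.range (D b).ι := by
      rintro _ ⟨t, rfl⟩
      simpa using hD (show t ∈ ⊤ from trivial)
    let l : T' ⟶ P (D b) := Over.homMk (IsOpenImmersion.lift (D b).ι f.left hrange) (by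
      change _ ≫ (D b).ι ≫ T.hom = _
      rw [IsOpenImmersion.lift_fac_assoc, Over.w])
    have hl : l.left ≫ (D b).ι = f.left := IsOpenImmersion.lift_fac _ _ _
    have hl' : l ≫ i (D b) = f := by ext1; exact hl
    rw [← appTop_evalAt l.left (D b).ι hl (ι_preimage_self_ge _) hD, hr]
    exact Φ.appTop_sectionVal s l _ _ _ (by rw [← Category.assoc, hl', hg])
      (by rw [← Category.assoc, hl', hx]) (by rw [← Category.assoc, hl', hfw]) _ _ _ _ _
  obtain ⟨p, hp⟩ := exists_glue T.left D ⊤ (fun _ ↦ le_top) (fun t _ ↦ by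
    obtain ⟨U, m, hx, hm⟩ := hL.exists_isFrame (w.left t)
    exact TopologicalSpace.Opens.mem_iSup.mpr ⟨⟨U, m, hm⟩, hx⟩) r (fun b b' ↦ by
    apply (evalAt_ι_bijective (D b ⊓ D b')).1
    have h1 : ⊤ ≤ (D b ⊓ D b').ι ⁻¹ᵁ D b := fun t _ ↦ t.2.1
    have h2 : ⊤ ≤ (D b ⊓ D b').ι ⁻¹ᵁ D b' := fun t _ ↦ t.2.2
    rw [evalAt_resFun _ _ _ h1, evalAt_resFun _ _ _ h2]
    refine (key (P (D b ⊓ D b')) (i _) b _ _ _ rfl rfl rfl (hP _) (hPb _ _ inf_le_left)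
      (hPc _) _).trans (Eq.trans ?_ (key (P (D b ⊓ D b')) (i _) b' _ _ _ rfl rfl rfl (hP _)
        (hPb _ _ inf_le_right) (hPc _) _).symm)
    exact Φ.sectionVal_change _ _ _ _ _ _ _)
  refine ⟨p, fun T' f b g' x' w' hg hx hfw hw' hb hc' ↦ ?_⟩
  have hD : ⊤ ≤ f.left ⁻¹ᵁ D b := by
    subst hfw
    exact hb
  rw [← key T' f b g' x' w' hg hx hfw hw' hb hc' hD, ← hp b, evalAt_resFun _ _ _ le_rfl]
  exact (evalAt_top _ _).symm

end Linearization

/-! ### Units at points and separation of points by functions -/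

namespace AlgebraicGeometry.Scheme

variable {X Y : Scheme.{u}}

lemma isUnit_evalAt_iff (f : X ⟶ Y) {V : Y.Opens} (hf : ⊤ ≤ f ⁻¹ᵁ V) (r : Γ(Y, V)) :
    IsUnit (evalAt f hf r) ↔ ⊤ ≤ f ⁻¹ᵁ Y.basicOpen r := by
  constructor
  · intro h
    have h1 := X.basicOpen_of_isUnit h
    have h2 : X.basicOpen (evalAt f hf r) = ⊤ ⊓ X.basicOpen (f.app V r) :=
      X.basicOpen_res (f.app V r) (homOfLE hf).op
    rw [Scheme.preimage_basicOpen, ← h1, h2]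
    exact inf_le_right
  · intro h
    rw [← evalAt_resFun f (Y.basicOpen_le r) h hf]
    exact (RingedSpace.isUnit_res_basicOpen _ r).map _

/-- The underlying space is T₀, and basic opens form neighbourhood bases inside an affine open. -/
lemma _root_.AlgebraicGeometry.IsAffineOpen.eq_of_forall_mem_basicOpen_iff {W : X.Opens} (hW : IsAffineOpen W) {x y : X}
    (hx : x ∈ W) (hy : y ∈ W) (h : ∀ a : Γ(X, W), x ∈ X.basicOpen a ↔ y ∈ X.basicOpen a) :
    x = y := by
  apply Inseparable.eq
  rw [inseparable_iff_forall_isOpen]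
  intro V hV
  constructor
  · intro hxV
    obtain ⟨a, ha, hxa⟩ := hW.exists_basicOpen_le (V := ⟨V, hV⟩) ⟨x, hxV⟩ hx
    exact ha ((h a).mp hxa)
  · intro hyV
    obtain ⟨a, ha, hya⟩ := hW.exists_basicOpen_le (V := ⟨V, hV⟩) ⟨y, hyV⟩ hy
    exact ha ((h a).mpr hya)

end AlgebraicGeometry.Scheme

/-! ### Orbits contained in an affine open, and points of `𝔾ₘ` and the affine line -/

section Gm

variable {k : Type u} [Field k] {Y : Over (Spec (.of k))}

/-- A curve in `Y` with both limits, contained together with its limits in an affine open set, is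
constant. -/
lemma eq_of_isAffineOpen {o : Gm k ⟶ Y} {φ φ' : affineLine k ⟶ Y}
    (h : GmToAffineLine k ≫ φ = o) (h' : GmToAffineLine k ≫ φ' = ι[Gm k] ≫ o)
    {W : Y.left.Opens} (hW : IsAffineOpen W) (ho : ⊤ ≤ o.left ⁻¹ᵁ W) (hφ : ⊤ ≤ φ.left ⁻¹ᵁ W)
    (hφ' : ⊤ ≤ φ'.left ⁻¹ᵁ W) (t₁ t₂ : (Gm k).left) : o.left t₁ = o.left t₂ := by
  let T : (k[T;T⁻¹])ˣ := (LaurentPolynomial.isUnit_T (R := k) 1).unit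
  have hT : gmPoint T = 𝟙 (Gm k) := by
    have : laurentHom (k := k) T = AlgHom.id k _ := laurent_algHom_ext (by simp [laurentHom_T, T])
    rw [gmPoint, this]
    ext1
    exact Spec.map_id _
  have hinv : ι[Gm k] = gmPoint T⁻¹ := by rw [gmPoint_inv, hT, Category.id_comp]
  have hlaur : (laurentHom (k := k) T⁻¹ : _ → _) = LaurentPolynomial.invert (R := k) := by
    have : laurentHom (k := k) T⁻¹ = (LaurentPolynomial.invert (R := k)).toAlgHom := by
      apply laurent_algHom_ext
      rw [laurentHom_T, zpow_one]
      refine Units.inv_eq_of_mul_eq_one_right ?_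
      change LaurentPolynomial.T 1 * LaurentPolynomial.invert (LaurentPolynomial.T 1) = 1
      rw [LaurentPolynomial.invert_T, ← LaurentPolynomial.T_add]
      simp
    rw [this]
    rfl
  refine hW.eq_of_forall_mem_basicOpen_iff (ho (show t₁ ∈ ⊤ from trivial))
    (ho (show t₂ ∈ ⊤ from trivial)) fun a ↦ ?_
  let P : k[T;T⁻¹] := specVal k _ (evalAt o.left ho a)
  let f : k[X] := specVal k _ (evalAt φ.left hφ a)
  let f' : k[X] := specVal k _ (evalAt φ'.left hφ' a)
  have hιo : ⊤ ≤ (ι[Gm k] ≫ o).left ⁻¹ᵁ W := comp_mem_of_mem _ _ rfl ho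
  have hf : f.toLaurent = P := by
    refine (specVal_appTop (Polynomial.toLaurentAlg (R := k)) _).symm.trans ?_
    exact congrArg _ (appTop_evalAt _ _ congr(($h).left) hφ ho a)
  have hf' : f'.toLaurent = LaurentPolynomial.invert P := by
    refine (specVal_appTop (Polynomial.toLaurentAlg (R := k)) _).symm.trans ?_
    refine (congrArg (specVal k _) (appTop_evalAt _ _ congr(($h').left) hφ' hιo a)).trans ?_
    rw [← hlaur]
    refine Eq.trans ?_ (specVal_appTop (laurentHom (k := k) T⁻¹) _)
    refine congrArg (specVal k _) (appTop_evalAt (gmPoint T⁻¹).left o.left ?_ ho hιo a).symm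
    rw [hinv]
    rfl
  have hdeg : f.natDegree = 0 := by
    by_contra hne
    -- Since `f(T⁻¹) = f'(T)`, in positive degree the right-hand side has zero constant term,
    -- whereas that of `f.reverse` is the leading coefficient of `f`.
    have h1 : f.reverse = f' * Polynomial.X ^ f.natDegree := by
      apply Polynomial.toLaurent_injective
      rw [LaurentPolynomial.toLaurent_reverse, hf, map_mul, hf', Polynomial.toLaurent_X_pow]
    have h2 := congr(Polynomial.coeff $h1 0)
    rw [Polynomial.coeff_zero_reverse, Polynomial.mul_coeff_zero, Polynomial.coeff_X_pow,
      if_neg (Ne.symm hne), mul_zero, Polynomial.leadingCoeff_eq_zero] at h2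
    exact hne (by rw [h2, Polynomial.natDegree_zero])
  have hP : P = algebraMap k _ (f.coeff 0) := by
    rw [← hf, Polynomial.eq_C_of_natDegree_eq_zero hdeg]
    simp
  -- A constant is zero or a unit, so the orbit either misses the basic open set of `a` or lies
  -- inside it.
  have hcase : (∀ t : (Gm k).left, o.left t ∈ Y.left.basicOpen a) ∨
      (∀ t : (Gm k).left, o.left t ∉ Y.left.basicOpen a) := by
    by_cases h0 : f.coeff 0 = 0
    · right
      intro t ht
      have hzero : evalAt o.left ho a = 0 := by
        apply specVal_bijective.1
        rw [map_zero]
        change P = 0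
        rw [hP, h0, map_zero]
      have h3 : t ∈ o.left ⁻¹ᵁ Y.left.basicOpen a := ht
      rw [Scheme.preimage_basicOpen] at h3
      have h4 : t ∈ (Gm k).left.basicOpen (evalAt o.left ho a) := by
        have h2 : (Gm k).left.basicOpen (evalAt o.left ho a) =
            ⊤ ⊓ (Gm k).left.basicOpen (o.left.app W a) :=
          (Gm k).left.basicOpen_res (o.left.app W a) (homOfLE ho).op
        rw [h2]
        exact ⟨trivial, h3⟩
      rw [hzero, Scheme.basicOpen_zero] at h4
      exact h4
    · left
      have hunit : IsUnit (evalAt o.left ho a) := by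
        have h1 : IsUnit P := by
          rw [hP]
          exact (IsUnit.mk0 _ h0).map _
        exact (isUnit_map_iff (RingEquiv.ofBijective _ (specVal_bijective (k := k)))
          (evalAt o.left ho a)).mp h1
      exact fun t ↦ (isUnit_evalAt_iff _ _ _).mp hunit (show t ∈ ⊤ from trivial)
  rcases hcase with hc | hc
  · exact iff_of_true (hc _) (hc _)
  · exact iff_of_false (hc _) (hc _)

/-- The generic point and the identity differ, as `T - 1` vanishes at the identity only. -/
lemma exists_ne_point_Gm : ∃ t₁ t₂ : (Gm k).left, t₁ ≠ t₂ := by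
  refine ⟨(⊥ : PrimeSpectrum k[T;T⁻¹]), PrimeSpectrum.comap
    (laurentHom (k := k) (1 : kˣ)).toRingHom (⊥ : PrimeSpectrum k), fun h ↦ ?_⟩
  have h1 : (LaurentPolynomial.T 1 - 1 : k[T;T⁻¹]) ∈ (PrimeSpectrum.comap
    (laurentHom (k := k) (1 : kˣ)).toRingHom (⊥ : PrimeSpectrum k)).asIdeal := by
    change laurentHom (k := k) (1 : kˣ) (LaurentPolynomial.T 1 - 1) ∈ (⊥ : Ideal k)
    rw [map_sub, laurentHom_T, map_one]
    simp
  rw [← h] at h1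
  have h2 : (LaurentPolynomial.T 1 - 1 : k[T;T⁻¹]) = 0 := h1
  rw [sub_eq_zero, ← LaurentPolynomial.T_zero] at h2
  have h3 := congr(laurentHom (ratX k) $h2)
  rw [laurentHom_T, laurentHom_T] at h3
  exact one_ne_zero (zpow_ratX_inj (v := 1) (w := 1) congr($h3 * _))

lemma lands_of_mem {x : 𝟙_ (Over (Spec (.of k))) ⟶ Y} {V : Y.left.Opens}
    (h : x.left (⊥ : PrimeSpectrum k) ∈ V) : ⊤ ≤ x.left ⁻¹ᵁ V := fun q _ ↦ by
  have : q = (⊥ : PrimeSpectrum k) := Subsingleton.elim (α := PrimeSpectrum k) _ _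
  rw [this]
  exact h

/-- The affine line is the union of the multiplicative group and the origin. -/
lemma affineLine_lands {φ : affineLine k ⟶ Y} {W : Y.left.Opens}
    (h : ⊤ ≤ (GmToAffineLine k ≫ φ).left ⁻¹ᵁ W)
    (h₀ : ⊤ ≤ (affineLineZero k ≫ φ).left ⁻¹ᵁ W) : ⊤ ≤ φ.left ⁻¹ᵁ W := by
  intro q _
  let q' : PrimeSpectrum k[X] := q
  by_cases hq : Polynomial.X ∈ q'.asIdeal
  -- A prime containing `X` is the kernel of evaluation at `0`; the remaining primes come from the
  -- localization `k[T, T⁻¹]`.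
  · have : PrimeSpectrum.comap (Polynomial.evalRingHom (0 : k)) ⊥ = q' := by
      ext p
      change p.eval 0 = 0 ↔ p ∈ q'.asIdeal
      rw [← Polynomial.coeff_zero_eq_eval_zero]
      refine ⟨fun hp ↦ Ideal.mem_of_dvd _ (Polynomial.X_dvd_iff.mpr hp) hq, fun hp ↦ ?_⟩
      by_contra hne
      refine q'.isPrime.ne_top (Ideal.eq_top_of_isUnit_mem _ (x := Polynomial.C (p.coeff 0)) ?_
        ((IsUnit.mk0 _ hne).map Polynomial.C))
      rw [← Polynomial.divX_mul_X_add p] at hp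
      exact (Ideal.add_mem_iff_right _ (Ideal.mul_mem_left _ _ hq)).mp hp
    have h1 := h₀ (show (show (𝟙_ (Over (Spec (.of k)))).left from (⊥ : PrimeSpectrum k)) ∈ ⊤
      from trivial)
    have h2 : (affineLineZero k).left (⊥ : PrimeSpectrum k) = q := this
    rw [← h2]
    exact h1
  · have : q' ∈ Set.range (PrimeSpectrum.comap (algebraMap k[X] k[T;T⁻¹])) := by
      rw [PrimeSpectrum.localization_away_comap_range k[T;T⁻¹] (Polynomial.X : k[X])]
      exact hq
    obtain ⟨t, ht⟩ := this
    have h1 := h (show (show (Gm k).left from t) ∈ ⊤ from trivial)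
    have h2 : (GmToAffineLine k).left t = q := ht
    rw [← h2]
    exact h1

end Gm

/-! ### Nonvanishing along the orbit -/

section Main

variable {k : Type u} [Field k] {Y : Over (Spec (.of k))} [ModObj (Gm k) Y] {L : Y.left.Modules}
  {y z : 𝟙_ (Over (Spec (.of k))) ⟶ Y}

/-- The weights of a linearization at the two limits of an orbit with the same limit at `0` and at
`∞` are opposite. -/
lemma weight_add_eq_zero (Φ : Linearization (Gm k) Y L) {b : L.LocalFrame} {m m' : ℤ}
    {x : specOver k (RatField k) ⟶ Y}
    (h : ∃ hz h₁ h₂, Φ.specFactor (b := b) (b' := b) (gmPoint (ratT k ^ (1 : ℤ))) x (w := x)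
      hz h₁ h₂ = ((ratT k ^ m : (RatField k)ˣ) : RatField k))
    (h' : ∃ hz h₁ h₂, Φ.specFactor (b := b) (b' := b) (gmPoint (ratT k ^ (-1 : ℤ))) x (w := x)
      hz h₁ h₂ = ((ratT k ^ m' : (RatField k)ˣ) : RatField k)) : m' = -m := by
  obtain ⟨hz, h₁, _, h⟩ := h
  obtain ⟨hz', _, _, h'⟩ := h'
  have e1 : (1 : specOver k (RatField k) ⟶ Gm k) =
      gmPoint (ratT k ^ (1 : ℤ)) * gmPoint (ratT k ^ (-1 : ℤ)) := by
    rw [← gmPoint_mul, ← zpow_add, add_neg_cancel, zpow_zero, gmPoint_one]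
  -- The factor at the identity is an idempotent unit, hence `1`.
  have h3 := Φ.specFactor_mul (b := b) (b' := b) (b'' := b) 1 1 x (one_smul _ _) (one_smul _ _)
    (by rw [one_mul, one_smul]) h₁ h₁ h₁
  have h4 : Φ.specFactor (b := b) (b' := b) 1 x (w := x) (one_smul _ _) h₁ h₁ = 1 := by
    have h5 := Φ.specFactor_congr (b := b) (b' := b) (mul_one (1 : specOver k (RatField k) ⟶ Gm k))
      (rfl : x = x) (w := x) (w' := x) (by rw [one_mul, one_smul]) (one_smul _ _) h₁ h₁ h₁ h₁
    rw [h5] at h3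
    exact (mul_eq_left₀ (Φ.isUnit_specFactor _ _ _ _ _).ne_zero).mp h3.symm
  -- Multiplicativity for `t * t⁻¹ = 1` at the fixed point `x` gives `t ^ m * t ^ m' = 1`.
  have h6 := Φ.specFactor_mul (b := b) (b' := b) (b'' := b) _ _ x hz' hz
    (by rw [← e1, one_smul]) h₁ h₁ h₁
  rw [h, h', ← Φ.specFactor_congr (b := b) (b' := b) e1 (rfl : x = x) (w := x) (w' := x)
    (one_smul _ _) _ h₁ h₁ h₁ h₁, h4, ← Units.val_mul, ← zpow_add] at h6
  have h7 : ratT k ^ (m + m') = ratT k ^ (0 : ℤ) := by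
    rw [zpow_zero]
    exact Units.ext h6.symm
  have := zpow_ratT_inj h7
  omega

/-- The restriction of a section to the orbit, at a point of the orbit near the limit. -/
lemma exists_sectionVal_eq {e m : ℤ} {φ : affineLine k ⟶ Y} (h : ExtendsOrbit y z e φ)
    (Φ : Linearization (Gm k) Y L)
    {b c : L.LocalFrame} (hb : b.Lands z.left) {n : ℕ} (s : Γ(L.tensorPow n, ⊤))
    (hs : ⊤ ≤ z.left ⁻¹ᵁ (L.tensorPow n).nonvanishingLocus s)
    (hm : ∀ (w : _) (hw) (h₁) (h₂), ∃ v : (RatSeries k)ˣ,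
        Φ.specFactor (b := b) (b' := c) (gmPoint (ratX k ^ e))
          (toUnit (specOver k (RatLaurent k)) ≫ y) (w := w) hw h₁ h₂ =
        ((ratX k ^ m : (RatLaurent k)ˣ) : RatLaurent k) *
          algebraMap (RatSeries k) (RatLaurent k) v)
    (w : specOver k (RatLaurent k) ⟶ Y)
    (hw : gmPoint (ratX k ^ e) • (toUnit (specOver k (RatLaurent k)) ≫ y) = w)
    (hc : c.Lands (toUnit (specOver k (RatLaurent k)) ≫ y).left) :
    ∃ (h₁ : b.Lands w.left) (v : (RatSeries k)ˣ),
      specVal k _ (Φ.sectionVal s (gmPoint (ratX k ^ e)) _ hw h₁ hc) =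
        ((ratX k ^ (n * m) : (RatLaurent k)ˣ) : RatLaurent k) *
          algebraMap (RatSeries k) (RatLaurent k) v := by
  have hX : PowerSeries.constantCoeff (PowerSeries.X : RatSeries k) = 0 := by simp
  obtain rfl : w = affinePoint (k := k) (ratX k : RatLaurent k) ≫ φ :=
    hw.symm.trans (h.affinePoint_unit _ _).symm
  have hB := h.lands_series hb hX
  have hK : specOverMap (IsScalarTower.toAlgHom k (RatSeries k) (RatLaurent k)) ≫
      affinePoint PowerSeries.X ≫ φ = affinePoint (k := k) (ratX k : RatLaurent k) ≫ φ :=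
    specOverMap_comp_affinePoint_comp _ _ rfl
  have hl : b.Lands (affinePoint (k := k) (ratX k : RatLaurent k) ≫ φ).left :=
    LocalFrame.Lands.comp hB (specOverMap (IsScalarTower.toAlgHom k (RatSeries k)
      (RatLaurent k))).left congr(($hK).left)
  obtain ⟨v, hv⟩ := hm _ hw hl hc
  -- As `s` does not vanish at `z`, its coordinate is invertible in `k(t)[[x]]` and does not
  -- contribute to the order.
  have hunit : IsUnit (evalAt _ hB (b.coord s)) := by
    rw [isUnit_evalAt_iff]
    refine h.lands_series (fun t ht ↦ ?_) hX
    exact (b.mem_nonvanishingLocus_iff s (hb ht)).mp (hs ht)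
  have hunit' := hunit.map (specVal k (RatSeries k))
  refine ⟨hl, hunit'.unit * v ^ n, ?_⟩
  have h1 : specVal k _ (evalAt _ hl (b.coord s)) = algebraMap (RatSeries k) (RatLaurent k)
      (specVal k (RatSeries k) (evalAt _ hB (b.coord s))) := by
    rw [← appTop_evalAt _ _ congr(($hK).left) hB hl]
    exact specVal_appTop (IsScalarTower.toAlgHom k (RatSeries k) (RatLaurent k)) _
  rw [Linearization.sectionVal, map_mul, map_pow, h1]
  change _ * (Φ.specFactor _ _ _ _ _) ^ n = _
  rw [hv, Units.val_mul, Units.val_pow_eq_pow_val, map_mul, map_pow, mul_pow,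
    mul_comm (n : ℤ), zpow_mul, zpow_natCast, Units.val_pow_eq_pow_val, IsUnit.unit_spec]
  ring

/-- A section of a power of a linearized line bundle that does not vanish at the common limit of an
orbit does not vanish on the orbit. -/
lemma orbitMap_lands_nonvanishingLocus [IsSeparated Y.hom] {φ φ' : affineLine k ⟶ Y}
    (h : ExtendsOrbit y z 1 φ) (h' : ExtendsOrbit y z (-1) φ') (hL : L.IsLineBundle)
    (Φ : Linearization (Gm k) Y L) {n : ℕ} (s : Γ(L.tensorPow n, ⊤))
    (hs : ⊤ ≤ z.left ⁻¹ᵁ (L.tensorPow n).nonvanishingLocus s) :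
    ⊤ ≤ (orbitMap (Gm k) y).left ⁻¹ᵁ (L.tensorPow n).nonvanishingLocus s := by
  have hpt (x : 𝟙_ (Over (Spec (.of k))) ⟶ Y) : ∃ b : L.LocalFrame, b.Lands x.left := by
    obtain ⟨U, m, hx, hm⟩ := hL.exists_isFrame (x.left (⊥ : PrimeSpectrum k))
    exact ⟨⟨U, m, hm⟩, lands_of_mem hx⟩
  obtain ⟨b, hb⟩ := hpt z
  obtain ⟨c, hc⟩ := hpt y
  have hy (R : Type u) [CommRing R] [Algebra k R] : c.Lands (toUnit (specOver k R) ≫ y).left :=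
    lands_of_toUnit_comp_eq y hc _ rfl
  obtain ⟨m, hm, hm₁⟩ := h.exists_weight Φ hb hc
  obtain ⟨m', hm', hm₁'⟩ := h'.exists_weight Φ hb hc
  obtain rfl := weight_add_eq_zero Φ hm hm'
  have ho : 𝟙 (Gm k) • (toUnit (Gm k) ≫ y) = orbitMap (Gm k) y := by
    rw [← comp_orbitMap, Category.id_comp]
  -- The section `s` along the whole orbit, trivialized by transporting the frame `c` at `y`;
  -- evaluating `p` at `x` and `x⁻¹` then gives its orders at `0` and `∞`.
  obtain ⟨p, hp⟩ := Φ.exists_eq_sectionVal hL s (toUnit (Gm k) ≫ y) (orbitMap (Gm k) y) (𝟙 _) ho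
    (hy k[T;T⁻¹])
  have hpK {e m : ℤ} {φ : affineLine k ⟶ Y} (h : ExtendsOrbit y z e φ)
      (hm : ∀ (w : _) (hw) (h₁) (h₂), ∃ v : (RatSeries k)ˣ,
        Φ.specFactor (b := b) (b' := c) (gmPoint (ratX k ^ e))
          (toUnit (specOver k (RatLaurent k)) ≫ y) (w := w) hw h₁ h₂ =
        ((ratX k ^ m : (RatLaurent k)ˣ) : RatLaurent k) *
          algebraMap (RatSeries k) (RatLaurent k) v) : ∃ v : (RatSeries k)ˣ,
      laurentHom (ratX k ^ e) (specVal k k[T;T⁻¹] p) =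
        ((ratX k ^ (n * m) : (RatLaurent k)ˣ) : RatLaurent k) *
          algebraMap (RatSeries k) (RatLaurent k) v := by
    obtain ⟨h₁, v, hv⟩ := exists_sectionVal_eq h Φ hb s hs hm _ rfl (hy _)
    refine ⟨v, ?_⟩
    rw [← hv, ← specVal_appTop]
    exact congrArg _ (hp (specOver k (RatLaurent k)) (gmPoint (ratX k ^ e)) b _ _ _
      (Category.comp_id _) (specOverMap_comp_toUnit_comp _ _) (comp_orbitMap _ _) rfl h₁ (hy _))
  obtain ⟨v, hv⟩ := hpK h hm₁
  obtain ⟨v', hv'⟩ := hpK h' hm₁'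
  rw [zpow_one] at hv
  rw [zpow_neg_one, mul_neg] at hv'
  have hunit : IsUnit p := (isUnit_map_iff (RingEquiv.ofBijective _ (specVal_bijective (k := k)))
    p).mp (isUnit_laurent hv hv')
  intro t _
  obtain ⟨V, m, hx, hm⟩ := hL.exists_isFrame ((orbitMap (Gm k) y).left t)
  let b' : L.LocalFrame := ⟨V, m, hm⟩
  let D : (Gm k).left.Opens := (orbitMap (Gm k) y).left ⁻¹ᵁ V
  let i : Over.mk (D.ι ≫ (Gm k).hom) ⟶ Gm k := Over.homMk D.ι
  have hbD : b'.Lands (i ≫ orbitMap (Gm k) y).left := fun t _ ↦ t.2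
  have hval := hp _ i b' (i ≫ 𝟙 _) (i ≫ toUnit (Gm k) ≫ y) (i ≫ orbitMap (Gm k) y) rfl rfl rfl
    (by rw [← ModObj.comp_smul, ho]) hbD (LocalFrame.Lands.comp (hy k[T;T⁻¹]) i.left rfl)
  have hu := hunit.map i.left.appTop.hom
  -- On `D` the unit `p` is the coordinate of `s` times a power of the factor, so the coordinate is
  -- itself a unit.
  have hu2 := isUnit_of_mul_isUnit_left (hval ▸ hu)
  have h3 := (isUnit_evalAt_iff _ _ _).mp hu2 (show (⟨t, hx⟩ : D) ∈ ⊤ from trivial)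
  exact (b'.mem_nonvanishingLocus_iff s hx).mpr h3

end Main

end

theorem mainTheorem3 (k : Type u) [Field k] (Y : Over (Spec (CommRingCat.of k)))
    [IsIntegral Y.left] [IsSeparated Y.hom] [LocallyOfFiniteType Y.hom] [QuasiCompact Y.hom]
    [ModObj (Gm k) Y] (y z : 𝟙_ (Over (Spec (CommRingCat.of k))) ⟶ Y)
    (U : Y.left.Opens) (hU : (U : Set Y.left) = Set.range (orbitMap (Gm k) y).left)
    (hdense : Dense (U : Set Y.left)) (hiso : Nonempty (Over.mk (U.ι ≫ Y.hom) ≅ Gm k))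
    (hzero : TendsToAtZero (orbitMap (Gm k) y) z) (hinfty : TendsToAtInfinity (orbitMap (Gm k) y) z) :
    ¬ ∃ L : Y.left.Modules, L.IsAmple ∧ Nonempty (Linearization (Gm k) Y L) := by
  rintro ⟨L, hample, ⟨Φ⟩⟩
  obtain ⟨φ, hφ, h⟩ := hzero.exists_extendsOrbit
  obtain ⟨φ', hφ', h'⟩ := hinfty.exists_extendsOrbit
  obtain ⟨n, -, s, hs, haff⟩ := hample.exists_isAffineOpen (z.left (⊥ : PrimeSpectrum k))
  have ho := orbitMap_lands_nonvanishingLocus h h' hample.isLineBundle Φ s (lands_of_mem hs)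
  -- Each affine line lands in `X_s` because its punctured part is the orbit and its origin goes to
  -- `z`.
  have hconst := eq_of_isAffineOpen hφ hφ' haff ho
    (affineLine_lands (by rw [hφ]; exact ho) (by rw [h.affineLineZero_comp]; exact lands_of_mem hs))
    (affineLine_lands (by
      rw [hφ']; exact AlgebraicGeometry.Scheme.comp_mem_of_mem (ι[Gm k]).left _ rfl ho)
      (by rw [h'.affineLineZero_comp]; exact lands_of_mem hs))
  obtain ⟨e⟩ := hiso
  obtain ⟨t₁, t₂, hne⟩ := exists_ne_point_Gm (k := k)
  apply hne
  -- Two distinct points of `𝔾ₘ` are carried by the isomorphism to points of `U`, both in the image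
  -- of the orbit map, which is a single point.
  have hinv (t : (Gm k).left) : e.hom.left (e.inv.left t) = t :=
    congr(($(e.inv_hom_id)).left t)
  rw [← hinv t₁, ← hinv t₂]
  congr 1
  have hmem (x : (U : AlgebraicGeometry.Scheme)) :
      x.1 ∈ Set.range (orbitMap (Gm k) y).left := hU ▸ x.2
  apply Subtype.ext
  obtain ⟨a, ha⟩ := hmem (e.inv.left t₁)
  obtain ⟨b, hb⟩ := hmem (e.inv.left t₂)
  exact ha.symm.trans ((hconst a b).trans hb)
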